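/- **Setting.** Let $G:\mathbb R\to\mathbb R$ be strictly increasing and convex on $[0,\infty)$, with $G(0)=0$, $G(-x)=G(x)$, and $G(y)/G(x)\le C_G\,(y/x)^2$ for all $0<x<y$. For a vector $v$ and positive weights $w$, the weighted Orlicz norm $\|v\|_{G,w}$ is $0$ if $v=0$ and otherwise the unique $\beta>0$ with $\sum_i w_i\,G(|v_i|/\beta)=1$; $\|v\|_G$ is the case of unit weights. The condition number of a matrix is the ratio of its largest to its smallest nonzero singular value. The condition number of a stream of rows is the largest condition number of a matrix formed by consecutive rows. **Algorithm** (online $L_1$-sensitivity sampling with parameters $\alpha,\Delta$). Start with $M=\emptyset$. When a row $a$ arrives, let $\operatorname{span}(M)$ be the span of the rows of $M$. If $a\in\operatorname{span}(M)$, put $$\tau=2\Delta\cdot\max_{x\in\operatorname{span}(M)}\frac{|\langle a,x\rangle|}{\|Mx\|_1+|\langle a,x\rangle|}\qquad(0/0=0);$$ otherwise put $\tau=1$. Let $p=\min(1,\alpha\tau)$. With probability $p$ (fresh randomness) append to $M$ the row $a$ reweighted by $1/p$. In $\|Mx\|_1$ the rows of $M$ are $a/p$. The Orlicz norm of the weighted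 sample is $\|Mx\|_G:=\|(\langle a,x\rangle)_{a\in M}\|_{G,w}$ with weights $w_a=1/p_a$, i.e. the $\beta$ with $\sum_{a\in M}\frac1{p_a}G(|\langle a,x\rangle|/\beta)=1$. **Theorem.** For all $C_G$ and all $b,c\in\mathbb N$ there is $C_0>0$ such that for every $C\ge C_0$ there is $K>0$ with the following property. Let $G$ be as above with constant $C_G$, let $n\ge2$ and $d$ be natural numbers, and let $A\in\mathbb R^{n\times d}$ have integer entries of magnitude at most $n^b$. Suppose the rows $a_1,\dots,a_n$ of $A$ form a stream with condition number at most $\kappa$, where $\kappa\ge2$. Let $0<\epsilon<1/2$, and let $\mathcal N\subset\mathbb R^d$ be an $\epsilon$-net of the unit sphere: $\|Ax\|_G=1$ for all $x\in\mathcal N$, and every $z$ with $\|Az\|_G=1$ has some $x\in\mathcal N$ with $\|Az-Ax\|_G\le\epsilon$. Let $\Delta_1,\Delta_2>0$ satisfy $\Delta_1\le|\langle a_j,x\rangle|\le\Delta_2$ for all $x\in\mathcal N$ and all $j$ with $\langle a_j,x\rangle\ne0$, and let $$\Delta\ \ge\ \frac{G(\Delta_2)\,\Delta_1}{G(\Delta_1)\,\Delta_2}.$$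 Run the algorithm on $a_1,\dots,a_n$ with this $\Delta$ and $\alpha=\frac{Cd}{\epsilon^2}\log n$, and let $M$ be its output. With probability at least $1-n^{-c}$, both of the following hold: 1. $\big|\,\|Mx\|_G-\|Ax\|_G\,\big|\le\epsilon\,\|Ax\|_G$ for all $x\in\mathbb R^d$; 2. $M$ has at most $K\,\frac{d^2\Delta}{\epsilon^2}\,\log^2 n\,\log\kappa$ rows. -/

import Mathlib

open scoped Matrix ENNReal NNReal

noncomputable section

namespace OrliczStream

/-! ### Orlicz norms -/

/-- The standing assumptions on the function `G` defining the Orlicz norm; `CG` is the constant of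
the quadratic growth condition. -/
structure IsOrliczFunction (G : ℝ → ℝ) (CG : ℝ) : Prop where
  strictMono : StrictMonoOn G (Set.Ici 0)
  convex : ConvexOn ℝ (Set.Ici 0) G
  map_zero : G 0 = 0
  even : ∀ x, G (-x) = G x
  growth : ∀ x y, 0 < x → x < y → G y / G x ≤ CG * (y / x) ^ 2

open Classical in
/-- The weighted Orlicz norm of `v` with weights `w`: the value `β > 0` (unique for `G` as above and
positive weights) with `∑ i, w i * G (|v i| / β) = 1`, and `0` when there is none, that is, when
`v = 0`. -/
def weightedOrliczNorm (G : ℝ → ℝ) {ι : Type*} [Fintype ι] (w v : ι → ℝ) : ℝ :=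
  if h : ∃ β : ℝ, 0 < β ∧ ∑ i, w i * G (|v i| / β) = 1 then h.choose else 0

/-- The Orlicz norm of a vector: all weights are `1`. -/
def orliczNorm (G : ℝ → ℝ) {ι : Type*} [Fintype ι] (v : ι → ℝ) : ℝ :=
  weightedOrliczNorm G (fun _ => 1) v

/-! ### Condition number of a stream -/

/-- The ratio of the largest singular value to the smallest nonzero singular value (`0` for the zero
matrix).  Mathlib lists singular values in descending order, starting at index `0`; the nonzero ones
are those with index less than the rank. -/
def conditionNumber {m n : Type*} [Fintype m] [Fintype n] [DecidableEq n]
    (B : Matrix m n ℝ) : ℝ :=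
  (Matrix.toLpLin 2 2 B).singularValues 0 /
    (Matrix.toLpLin 2 2 B).singularValues (B.rank - 1)

/-- The matrix formed by the consecutive rows `i, …, j` of `A`. -/
def consecutiveRows {n d : ℕ} (A : Matrix (Fin n) (Fin d) ℝ) (i j : Fin n) :
    Matrix {k : Fin n // i ≤ k ∧ k ≤ j} (Fin d) ℝ :=
  A.submatrix Subtype.val id

/-- The condition number of the stream of the rows of `A`: the largest condition number of a
matrix formed by consecutive rows. -/
def streamConditionNumber {n d : ℕ} (A : Matrix (Fin n) (Fin d) ℝ) : ℝ :=
  ⨆ ij : {p : Fin n × Fin n // p.1 ≤ p.2}, conditionNumber (consecutiveRows A ij.1.1 ij.1.2)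

/-! ### The online sampling algorithm -/

/-- A sampled row `a` together with the probability `p` with which it was sampled.  It stands for
the reweighted row `a / p`. -/
structure SampledRow (d : ℕ) where
  row : Fin d → ℝ
  prob : ℝ

/-- The memory of the algorithm: the rows sampled so far, in order of arrival. -/
abbrev Sample (d : ℕ) := List (SampledRow d)

/-- The span of the reweighted rows `a / p` in memory. -/
def Sample.rowSpan {d : ℕ} (M : Sample d) : Submodule ℝ (Fin d → ℝ) :=
  Submodule.span ℝ {v | ∃ s ∈ M, v = s.prob⁻¹ • s.row}

/-- The `L₁` norm of `M x`, where `M` has the reweighted rows `a / p`. -/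
def Sample.l1Norm {d : ℕ} (M : Sample d) (x : Fin d → ℝ) : ℝ :=
  (M.map fun s => |(s.prob⁻¹ • s.row) ⬝ᵥ x|).sum

/-- The Orlicz norm of `M x` for the weighted subset of rows `M`: every sampled row `a` contributes
`G (|⟨a, x⟩| / β)` with weight `1 / p`. -/
def Sample.orliczNorm {d : ℕ} (G : ℝ → ℝ) (M : Sample d) (x : Fin d → ℝ) : ℝ :=
  weightedOrliczNorm G (fun k : Fin M.length => (M.get k).prob⁻¹)
    (fun k : Fin M.length => (M.get k).row ⬝ᵥ x)

open Classical in
/-- The importance `τ` of an arriving row `a`: `2 Δ` times its `L₁` sensitivity with respect to the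
current sample (with `0 / 0 = 0`) if `a` lies in the span of the sample, and `1` otherwise. -/
def importance {d : ℕ} (Δ : ℝ) (M : Sample d) (a : Fin d → ℝ) : ℝ :=
  if a ∈ M.rowSpan then
    2 * Δ * ⨆ x : M.rowSpan, |a ⬝ᵥ (x : Fin d → ℝ)| / (M.l1Norm x + |a ⬝ᵥ (x : Fin d → ℝ)|)
  else 1

/-- The sampling probability `p = min (1, α τ)`. -/
def samplingProb {d : ℕ} (α Δ : ℝ) (M : Sample d) (a : Fin d → ℝ) : ℝ≥0 :=
  min 1 (α * importance Δ M a).toNNReal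

/-- The law of one coin flip: `true` with probability `p`. -/
def coin (p : ℝ≥0) (hp : p ≤ 1) : PMF Bool :=
  PMF.ofFintype (fun b => if b then (p : ℝ≥0∞) else ((1 - p : ℝ≥0) : ℝ≥0∞)) (by
    simp only [Fintype.sum_bool, if_true, Bool.false_eq_true, if_false]
    rw [← ENNReal.coe_add, add_tsub_cancel_of_le hp, ENNReal.coe_one])

/-- One step: the arriving row is irrevocably appended with probability `p`, or discarded. -/
def step {d : ℕ} (α Δ : ℝ) (M : Sample d) (a : Fin d → ℝ) : PMF (Sample d) :=
  (coin (samplingProb α Δ M a) (min_le_left _ _)).map fun b =>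
    if b then M ++ [⟨a, (samplingProb α Δ M a : ℝ)⟩] else M

/-- The law of the output of the one-pass algorithm on the stream of the rows of `A`, started with
empty memory. -/
def sampleLaw {n d : ℕ} (α Δ : ℝ) (A : Matrix (Fin n) (Fin d) ℝ) : PMF (Sample d) :=
  (List.ofFn A.row).foldl (fun μ a => μ.bind fun M => step α Δ M a) (PMF.pure [])

/-- The oversampling parameter `α = C d log n / ε²`. -/
def oversampling (C : ℝ) (n d : ℕ) (ε : ℝ) : ℝ := C * d / ε ^ 2 * Real.log n

/-! ### Nets and the aspect ratio -/

/-- `N` is an `ε`-net of the unit sphere `{A y : ‖A y‖_G = 1}`, given by preimages under `A`. -/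
def IsOrliczNet {n d : ℕ} (G : ℝ → ℝ) (A : Matrix (Fin n) (Fin d) ℝ) (ε : ℝ)
    (N : Set (Fin d → ℝ)) : Prop :=
  (∀ x ∈ N, orliczNorm G (A *ᵥ x) = 1) ∧
    ∀ z, orliczNorm G (A *ᵥ z) = 1 → ∃ x ∈ N, orliczNorm G (A *ᵥ z - A *ᵥ x) ≤ ε

/-- `M` is a `(1 + ε)` subspace embedding of `A` for the Orlicz norm. -/
def IsSubspaceEmbedding {n d : ℕ} (G : ℝ → ℝ) (A : Matrix (Fin n) (Fin d) ℝ) (ε : ℝ)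
    (M : Sample d) : Prop :=
  ∀ x : Fin d → ℝ,
    |M.orliczNorm G x - orliczNorm G (A *ᵥ x)| ≤ ε * orliczNorm G (A *ᵥ x)

end OrliczStream

end

noncomputable section

namespace OrliczStream

/-! ### Nets of seminorm spheres -/

/-! Everything rests on one comparison: as long as the `L₁` norm of the sample agrees up to a factor
2 with that of the prefix seen so far, the sampling probability of the next row is controlled from
both sides. From below, a row that can be discarded satisfies `α Δ |⟨a, x⟩| ≤ p ‖prefix x‖₁` for all
`x` (`samplingProb_eq_one_or_abs_dotProduct_le`). From above, `p` is at most a constant times `α Δ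
w`, where `w` bounds the online `L₁` sensitivity (`samplingProb_le`).

The sum of these `w` is `O(d log n log κ)`. Each row is added to a positive definite form `Q` with
the weight that makes it its own Lewis weight; then `det Q` grows by at least `exp w`, and `log det`
has only `O(d log (n κ))` room (`exists_online_lewis_weights`). The regularisation that makes the
initial `Q` invertible is harmless: integrality and the condition number provide preimages of
bounded length (`exists_mulVec_eq_and_sqrt_le`).

The lower bound on `p` becomes an Orlicz bound `G ⟨a, x⟩ ≤ p R` with `R = O(1/α)`. On the given net
all nonzero inner products lie in `[Δ₁, Δ₂]`, and monotonicity of `G t / t` costs exactly the aspect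
ratio that `Δ` dominates; the growth condition carries the bound to the whole sphere
(`apply_le_mul_of_isOrliczNet`). The given net serves only this purpose. Union bounds run over
finite nets built here by volume.

Sampling decisions depend on the past, so the factor-2 comparison cannot be assumed in advance. A
single potential adds exponential moments for the `L₁` deviations at all times, for the Orlicz
deviations at the end, and for the sample size. Below 1 it certifies the comparison at the present
time, which makes the next step a supermartingale step; at 1 or above, the desired bound is trivial
(`toOuterMeasure_lawFrom_le`, `toOuterMeasure_not_isGoodSample_le`).

The final net has `O(1/ε)^d` points, which is polynomial in `n` to the power `d` unless `ε` is below
`n^{-(b+1)}`. In that range `α` is so large that every nonzero row is kept with probability 1 and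
the sample is exact (`isDeterministicRegime_of_le`). -/

open MeasureTheory Metric Module in
theorem card_le_of_norm_le_one_of_separated {E : Type*} [NormedAddCommGroup E] [NormedSpace ℝ E]
    [FiniteDimensional ℝ E] {δ : ℝ} (hδ : 0 < δ) (s : Finset E) (hs : ∀ c ∈ s, ‖c‖ ≤ 1)
    (h : ∀ c ∈ s, ∀ d ∈ s, c ≠ d → δ ≤ ‖c - d‖) :
    (s.card : ℝ) ≤ (1 + 2 / δ) ^ finrank ℝ E := by
  borelize E
  let μ : Measure E := Measure.addHaar
  have hδ2 : 0 < δ / 2 := by positivity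
  have ρpos : 0 < 1 + δ / 2 := by positivity
  have hdisj : Set.Pairwise (s : Set E) (Function.onFun Disjoint fun c => ball (c : E) (δ / 2)) := by
    rintro c hc d hd hcd
    apply ball_disjoint_ball
    rw [dist_eq_norm]
    have := h c hc d hd hcd
    linarith
  have hsub : (⋃ c ∈ s, ball (c : E) (δ / 2)) ⊆ ball (0 : E) (1 + δ / 2) := by
    refine Set.iUnion₂_subset fun x hx => ?_
    apply ball_subset_ball'
    rw [dist_zero_right]
    have := hs x hx
    linarith
  have hvol : (s.card : ℝ≥0∞) * ENNReal.ofReal ((δ / 2) ^ finrank ℝ E) * μ (ball 0 1) ≤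
      ENNReal.ofReal ((1 + δ / 2) ^ finrank ℝ E) * μ (ball 0 1) :=
    calc
      _ = μ (⋃ c ∈ s, ball (c : E) (δ / 2)) := by
        rw [measure_biUnion_finset hdisj fun c _ => measurableSet_ball]
        simp only [μ.addHaar_ball_of_pos _ hδ2]
        simp only [Finset.sum_const, nsmul_eq_mul, mul_assoc]
      _ ≤ μ (ball (0 : E) (1 + δ / 2)) := measure_mono hsub
      _ = _ := by simp only [μ.addHaar_ball_of_pos _ ρpos]
  have hcard : (s.card : ℝ≥0∞) * ENNReal.ofReal ((δ / 2) ^ finrank ℝ E) ≤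
      ENNReal.ofReal ((1 + δ / 2) ^ finrank ℝ E) :=
    (ENNReal.mul_le_mul_iff_left (measure_ball_pos _ _ zero_lt_one).ne' measure_ball_lt_top.ne).1 hvol
  have hreal := ENNReal.toReal_le_of_le_ofReal (pow_nonneg ρpos.le _) hcard
  rw [ENNReal.toReal_mul, ENNReal.toReal_natCast, ENNReal.toReal_ofReal (by positivity)] at hreal
  have hp : 0 < (δ / 2) ^ finrank ℝ E := by positivity
  calc (s.card : ℝ) ≤ (1 + δ / 2) ^ finrank ℝ E / (δ / 2) ^ finrank ℝ E := by
        rwa [le_div_iff₀ hp]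
    _ = (1 + 2 / δ) ^ finrank ℝ E := by
        rw [← div_pow]; congr 1; field_simp; ring

/-- The separation quotient turns `p` into a norm. Points at positive `p`-distance stay distinct
there, and the dimension can only drop. -/
theorem card_le_of_seminorm_separated {E : Type*} [AddCommGroup E] [Module ℝ E]
    [FiniteDimensional ℝ E] (p : Seminorm ℝ E) {δ : ℝ} (hδ : 0 < δ) (s : Finset E)
    (hs : ∀ c ∈ s, p c ≤ 1) (h : ∀ c ∈ s, ∀ d ∈ s, c ≠ d → δ ≤ p (c - d)) :
    (s.card : ℝ) ≤ (1 + 2 / δ) ^ Module.finrank ℝ E := by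
  classical
  let _ := AddGroupSeminorm.toSeminormedAddCommGroup p.toAddGroupSeminorm
  let _ : NormedSpace ℝ E := ⟨fun a x => (map_smul_eq_mul p a x).le⟩
  have hnorm : ∀ x : E, ‖(SeparationQuotient.mk x)‖ = p x := fun x => rfl
  let L : E →ₗ[ℝ] SeparationQuotient E :=
    { toFun := SeparationQuotient.mk
      map_add' := fun _ _ => rfl
      map_smul' := fun _ _ => rfl }
  have hL : Function.Surjective L := SeparationQuotient.surjective_mk
  have : FiniteDimensional ℝ (SeparationQuotient E) := Module.Finite.of_surjective L hL
  have hinj : Set.InjOn L s := by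
    intro c hc d hd hcd
    by_contra hne
    have h1 := h c hc d hd hne
    have h2 : ‖L (c - d)‖ = p (c - d) := hnorm _
    rw [map_sub, hcd, sub_self, norm_zero] at h2
    linarith
  have hcard := card_le_of_norm_le_one_of_separated hδ (s.image L)
    (by
      intro c hc
      obtain ⟨x, hx, rfl⟩ := Finset.mem_image.1 hc
      exact (hnorm x).le.trans (hs x hx))
    (by
      intro c hc d hd hcd
      obtain ⟨x, hx, rfl⟩ := Finset.mem_image.1 hc
      obtain ⟨y, hy, rfl⟩ := Finset.mem_image.1 hd
      rw [← map_sub]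
      exact (h x hx y hy fun e => hcd (by rw [e])).trans (hnorm _).ge)
  rw [Finset.card_image_of_injOn hinj] at hcard
  refine hcard.trans (pow_le_pow_right₀ ?_ (LinearMap.finrank_le_finrank_of_surjective hL))
  have : 0 < 2 / δ := by positivity
  linarith

/-- Greedy packing: if no net of this size existed, every separated set could be enlarged,
eventually beyond the volume bound. -/
theorem exists_seminorm_net {E : Type*} [AddCommGroup E] [Module ℝ E]
    [FiniteDimensional ℝ E] (p : Seminorm ℝ E) {δ : ℝ} (hδ : 0 < δ) :
    ∃ N : Finset E, (N.card : ℝ) ≤ (1 + 2 / δ) ^ Module.finrank ℝ E ∧ (∀ x ∈ N, p x = 1) ∧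
      ∀ z, p z = 1 → ∃ x ∈ N, p (z - x) ≤ δ := by
  classical
  by_contra! hcon
  have key : ∀ m : ℕ, ∃ s : Finset E, s.card = m ∧ (∀ c ∈ s, p c = 1) ∧
      ∀ c ∈ s, ∀ d ∈ s, c ≠ d → δ ≤ p (c - d) := by
    intro m
    induction m with
    | zero => exact ⟨∅, by simp⟩
    | succ m ih =>
      obtain ⟨s, hm, hs, hsep⟩ := ih
      obtain ⟨z, hz, hzs⟩ := hcon s
        (card_le_of_seminorm_separated p hδ s (fun c hc => (hs c hc).le) hsep) hs
      have hzn : z ∉ s := fun hmem => by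
        have := hzs z hmem
        rw [sub_self, map_zero] at this
        linarith
      refine ⟨insert z s, by rw [Finset.card_insert_of_notMem hzn, hm], ?_, ?_⟩
      · intro c hc
        rcases Finset.mem_insert.1 hc with rfl | hc
        · exact hz
        · exact hs c hc
      · intro c hc d hd hcd
        rcases Finset.mem_insert.1 hc with rfl | hc' <;> rcases Finset.mem_insert.1 hd with rfl | hd'
        · exact absurd rfl hcd
        · exact (hzs d hd').le
        · rw [map_sub_rev]; exact (hzs c hc').le
        · exact hsep c hc' d hd' hcd
  obtain ⟨m, hm⟩ := exists_nat_gt ((1 + 2 / δ) ^ Module.finrank ℝ E)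
  obtain ⟨s, hsm, hs, hsep⟩ := key m
  have := card_le_of_seminorm_separated p hδ s (fun c hc => (hs c hc).le) hsep
  rw [hsm] at this
  linarith

/-- The crude constant `B` makes the supremum `T` of `q` on the `p`-sphere finite and forces `q` to
vanish where `p` does; it does not enter the result. Approximating by the net gives `T ≤ 1 + η + δ
T`, which bootstraps to a sharp bound. -/
theorem abs_seminorm_sub_le_of_net {E : Type*} [AddCommGroup E] [Module ℝ E] (p q : Seminorm ℝ E)
    {B η δ : ℝ} (hδ1 : δ < 1) (hB : ∀ z, q z ≤ B * p z) (N : Set E)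
    (hN : ∀ z, p z = 1 → ∃ x ∈ N, p (z - x) ≤ δ) (hq : ∀ x ∈ N, |q x - 1| ≤ η) (z : E) :
    |q z - p z| ≤ (η + δ) / (1 - δ) * p z := by
  have h1δ : 0 < 1 - δ := by linarith
  have hhom : ∀ T : ℝ, (∀ z, p z = 1 → q z ≤ T) → ∀ z, q z ≤ T * p z := by
    intro T hT z
    rcases (apply_nonneg p z).eq_or_lt with h0 | hpos
    · have := hB z
      rw [← h0] at this ⊢
      simpa using this
    · have h1 : p ((p z)⁻¹ • z) = 1 := by
        rw [map_smul_eq_mul, Real.norm_of_nonneg (by positivity), inv_mul_cancel₀ hpos.ne']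
      have h2 := hT _ h1
      rw [map_smul_eq_mul, Real.norm_of_nonneg (by positivity), inv_mul_le_iff₀ hpos] at h2
      linarith
  by_cases hne : ∃ z, p z = 1
  swap
  · have h0 : p z = 0 := by
      by_contra hz
      apply hne
      refine ⟨(p z)⁻¹ • z, ?_⟩
      rw [map_smul_eq_mul, Real.norm_of_nonneg (by positivity), inv_mul_cancel₀ hz]
    have := hB z
    rw [h0, mul_zero] at this
    have h2 : q z = 0 := le_antisymm this (apply_nonneg q z)
    simp [h0, h2]
  obtain ⟨z₀, hz₀⟩ := hne
  set S : Set ℝ := {t | ∃ z, p z = 1 ∧ t = q z} with hS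
  have hbdd : BddAbove S := ⟨B, by
    rintro _ ⟨z, hz, rfl⟩
    have := hB z
    rwa [hz, mul_one] at this⟩
  have hSne : S.Nonempty := ⟨q z₀, z₀, hz₀, rfl⟩
  set T := sSup S with hT
  have hTz : ∀ z, p z = 1 → q z ≤ T := fun z hz => le_csSup hbdd ⟨z, hz, rfl⟩
  have hTall := hhom T hTz
  have hT0 : 0 ≤ T := (apply_nonneg q z₀).trans (hTz z₀ hz₀)
  have hTle : T ≤ 1 + η + δ * T := by
    apply csSup_le hSne
    rintro _ ⟨z, hz, rfl⟩
    obtain ⟨x, hx, hzx⟩ := hN z hz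
    have h1 : q z ≤ q x + q (z - x) := by
      have := map_add_le_add q x (z - x)
      rwa [add_sub_cancel] at this
    have h2 := (abs_le.1 (hq x hx)).2
    have h3 := hTall (z - x)
    have h4 : T * p (z - x) ≤ T * δ := mul_le_mul_of_nonneg_left hzx hT0
    linarith
  have hsphere : ∀ z, p z = 1 → |q z - 1| ≤ (η + δ) / (1 - δ) := by
    intro z hz
    have hT1 : T ≤ (1 + η) / (1 - δ) := by
      rw [le_div_iff₀ h1δ]; linarith
    have hTe : (1 + η) / (1 - δ) = 1 + (η + δ) / (1 - δ) := by field_simp; ring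
    rw [abs_le]
    constructor
    · obtain ⟨x, hx, hzx⟩ := hN z hz
      have h1 : q x ≤ q z + q (z - x) := by
        have := map_sub_le_add q z (z - x)
        rwa [sub_sub_cancel] at this
      have h2 := (abs_le.1 (hq x hx)).1
      have h3 := hTall (z - x)
      have h4 : T * p (z - x) ≤ (1 + η) / (1 - δ) * δ :=
        mul_le_mul hT1 hzx (apply_nonneg p _) (hT0.trans hT1)
      have h5 : (1 + η) / (1 - δ) * δ + η = (η + δ) / (1 - δ) := by field_simp; ring
      linarith
    · have := hTz z hz
      linarith
  rcases (apply_nonneg p z).eq_or_lt with h0 | hpos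
  · have := hB z
    rw [← h0, mul_zero] at this
    have h2 : q z = 0 := le_antisymm this (apply_nonneg q z)
    simp [← h0, h2]
  · have h1 : p ((p z)⁻¹ • z) = 1 := by
      rw [map_smul_eq_mul, Real.norm_of_nonneg (by positivity), inv_mul_cancel₀ hpos.ne']
    have h2 := hsphere _ h1
    rw [map_smul_eq_mul, Real.norm_of_nonneg (by positivity)] at h2
    have h3 : q z - p z = p z * ((p z)⁻¹ * q z - 1) := by field_simp
    rw [h3, abs_mul, abs_of_pos hpos, mul_comm]
    exact mul_le_mul_of_nonneg_right h2 hpos.le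

/-! ### Orlicz functions and Orlicz norms -/

namespace IsOrliczFunction

variable {G : ℝ → ℝ} {CG : ℝ}

theorem apply_abs (hG : IsOrliczFunction G CG) (x : ℝ) : G |x| = G x := by
  rcases abs_choice x with h | h <;> rw [h]
  exact hG.even x

theorem mono (hG : IsOrliczFunction G CG) {x y : ℝ} (hx : 0 ≤ x) (hxy : x ≤ y) : G x ≤ G y :=
  hG.strictMono.monotoneOn hx (hx.trans hxy : (0 : ℝ) ≤ y) hxy

theorem lt (hG : IsOrliczFunction G CG) {x y : ℝ} (hx : 0 ≤ x) (hxy : x < y) : G x < G y :=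
  hG.strictMono hx (hx.trans hxy.le : (0 : ℝ) ≤ y) hxy

theorem pos (hG : IsOrliczFunction G CG) {x : ℝ} (hx : 0 < x) : 0 < G x := by
  simpa [hG.map_zero] using hG.lt le_rfl hx

theorem nonneg (hG : IsOrliczFunction G CG) (x : ℝ) : 0 ≤ G x := by
  rw [← hG.apply_abs]
  simpa [hG.map_zero] using hG.mono le_rfl (abs_nonneg x)

theorem mul_le (hG : IsOrliczFunction G CG) {t x : ℝ} (ht : 0 ≤ t) (ht1 : t ≤ 1) (hx : 0 ≤ x) :
    G (t * x) ≤ t * G x := by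
  have := hG.convex.2 (le_refl (0 : ℝ) : (0 : ℝ) ∈ Set.Ici 0) (hx : x ∈ Set.Ici (0 : ℝ))
    (by linarith : 0 ≤ 1 - t) ht (by ring)
  simpa [hG.map_zero] using this

theorem le_mul (hG : IsOrliczFunction G CG) {t x : ℝ} (ht : 1 ≤ t) (hx : 0 ≤ x) :
    t * G x ≤ G (t * x) := by
  have ht0 : 0 < t := by linarith
  have := hG.mul_le (inv_nonneg.2 ht0.le) (inv_le_one_of_one_le₀ ht) (mul_nonneg ht0.le hx)
  rw [inv_mul_cancel_left₀ ht0.ne', inv_mul_eq_div, le_div_iff₀ ht0] at this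
  linarith

theorem apply_four_mul_le (hG : IsOrliczFunction G CG) {x : ℝ} (hx : 0 ≤ x) :
    G (4 * x) ≤ 16 * max CG 1 * G x := by
  rcases hx.eq_or_lt with rfl | hx
  · simp [hG.map_zero]
  · have h := hG.growth x (4 * x) hx (by linarith)
    rw [div_le_iff₀ (hG.pos hx), mul_div_cancel_right₀ _ hx.ne'] at h
    have h2 : CG * G x ≤ max CG 1 * G x :=
      mul_le_mul_of_nonneg_right (le_max_left _ _) (hG.nonneg x)
    nlinarith

theorem div_le_div (hG : IsOrliczFunction G CG) {x y : ℝ} (hx : 0 < x) (hxy : x ≤ y) :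
    G x / x ≤ G y / y := by
  have hy : 0 < y := hx.trans_le hxy
  have h := hG.mul_le (div_nonneg hx.le hy.le) ((div_le_one hy).2 hxy) hy.le
  rw [div_mul_cancel₀ _ hy.ne'] at h
  rw [div_le_div_iff₀ hx hy]
  rw [div_mul_eq_mul_div, le_div_iff₀ hy] at h
  linarith

theorem continuousOn (hG : IsOrliczFunction G CG) : ContinuousOn G (Set.Ioi 0) :=
  (hG.convex.subset Set.Ioi_subset_Ici_self (convex_Ioi 0)).continuousOn isOpen_Ioi

end IsOrliczFunction

section WeightedNorm

variable {G : ℝ → ℝ} {CG : ℝ} {ι : Type*} [Fintype ι] {w : ι → ℝ}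

theorem sum_mul_apply_div_antitone (hG : IsOrliczFunction G CG) (hw : ∀ i, 0 < w i) (v : ι → ℝ)
    {β γ : ℝ} (hβ : 0 < β) (hβγ : β ≤ γ) :
    ∑ i, w i * G (|v i| / γ) ≤ ∑ i, w i * G (|v i| / β) :=
  Finset.sum_le_sum fun i _ => mul_le_mul_of_nonneg_left
    (hG.mono (div_nonneg (abs_nonneg _) (hβ.le.trans hβγ))
      (div_le_div_of_nonneg_left (abs_nonneg _) hβ hβγ)) (hw i).le

theorem sum_mul_apply_div_strictAnti (hG : IsOrliczFunction G CG) (hw : ∀ i, 0 < w i) {v : ι → ℝ}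
    (hv : v ≠ 0) {β γ : ℝ} (hβ : 0 < β) (hβγ : β < γ) :
    ∑ i, w i * G (|v i| / γ) < ∑ i, w i * G (|v i| / β) := by
  obtain ⟨i, hi⟩ := Function.ne_iff.1 hv
  have hγ := hβ.trans hβγ
  refine Finset.sum_lt_sum (fun i _ => mul_le_mul_of_nonneg_left
    (hG.mono (div_nonneg (abs_nonneg _) hγ.le)
      (div_le_div_of_nonneg_left (abs_nonneg _) hβ hβγ.le)) (hw i).le)
    ⟨i, Finset.mem_univ i, mul_lt_mul_of_pos_left
      (hG.lt (div_nonneg (abs_nonneg _) hγ.le)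
        (div_lt_div_of_pos_left (abs_pos.2 hi) hβ hβγ)) (hw i)⟩

theorem exists_sum_mul_apply_div_eq_one (hG : IsOrliczFunction G CG) (hw : ∀ i, 0 < w i)
    {v : ι → ℝ} (hv : v ≠ 0) : ∃ β : ℝ, 0 < β ∧ ∑ i, w i * G (|v i| / β) = 1 := by
  obtain ⟨i, hi⟩ := Function.ne_iff.1 hv
  have hvi : 0 < |v i| := abs_pos.2 hi
  have hG1 : 0 < G 1 := hG.pos one_pos
  have hwi := hw i
  have hs1 : 1 ≤ 1 + 1 / (w i * G 1) := by
    have : 0 < 1 / (w i * G 1) := by positivity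
    linarith
  set β₁ := |v i| / (1 + 1 / (w i * G 1)) with hβ₁
  -- Intermediate value theorem: at `β₁` the `i`-th term alone is at least `w i * G 1 + 1`; at `β₂`
  -- below, all arguments are so small that convexity bounds the sum by 1.
  have hβ₁0 : 0 < β₁ := by positivity
  have hlow : 1 ≤ ∑ i, w i * G (|v i| / β₁) := by
    have h1 : |v i| / β₁ = (1 + 1 / (w i * G 1)) * 1 := by rw [hβ₁]; field_simp
    have h2 := hG.le_mul hs1 zero_le_one
    have h3 : 1 ≤ w i * G (|v i| / β₁) := by
      rw [h1]
      calc (1 : ℝ) ≤ w i * G 1 + 1 := by nlinarith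
        _ = w i * ((1 + 1 / (w i * G 1)) * G 1) := by field_simp
        _ ≤ _ := mul_le_mul_of_nonneg_left h2 hwi.le
    exact h3.trans (Finset.single_le_sum (f := fun i => w i * G (|v i| / β₁))
      (fun j _ => mul_nonneg (hw j).le (hG.nonneg _)) (Finset.mem_univ i))
  set V := ∑ i, |v i| with hV
  set W := ∑ i, w i with hW
  have hW0 : 0 ≤ W := Finset.sum_nonneg fun i _ => (hw i).le
  have hV0 : 0 < V := hvi.trans_le
    (Finset.single_le_sum (f := fun i => |v i|) (fun j _ => abs_nonneg _) (Finset.mem_univ i))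
  set β₂ := V * (1 + W * G 1) with hβ₂
  have hβ₂0 : 0 < β₂ := by positivity
  have hup : ∑ i, w i * G (|v i| / β₂) ≤ 1 := by
    have hterm : ∀ j, G (|v j| / β₂) ≤ 1 / (1 + W * G 1) * G 1 := by
      intro j
      have h1 : |v j| ≤ V :=
        Finset.single_le_sum (f := fun i => |v i|) (fun j _ => abs_nonneg _) (Finset.mem_univ j)
      have h2 : |v j| / β₂ ≤ 1 / (1 + W * G 1) * 1 := by
        rw [hβ₂, mul_one, div_le_div_iff₀ (by positivity) (by positivity)]
        have : 0 < 1 + W * G 1 := by positivity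
        nlinarith
      refine (hG.mono (by positivity) h2).trans (hG.mul_le (by positivity) ?_ zero_le_one)
      rw [div_le_one (by positivity)]
      have : 0 ≤ W * G 1 := by positivity
      linarith
    calc ∑ i, w i * G (|v i| / β₂) ≤ ∑ i, w i * (1 / (1 + W * G 1) * G 1) :=
          Finset.sum_le_sum fun j _ => mul_le_mul_of_nonneg_left (hterm j) (hw j).le
      _ = W * G 1 / (1 + W * G 1) := by rw [← Finset.sum_mul]; ring
      _ ≤ 1 := by
        rw [div_le_one (by positivity)]; linarith
  have hcont : ContinuousOn (fun β => ∑ i, w i * G (|v i| / β)) (Set.Ioi 0) := by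
    refine continuousOn_finsetSum _ fun j _ => continuousOn_const.mul ?_
    by_cases hj : v j = 0
    · simp only [hj, abs_zero, zero_div]; exact continuousOn_const
    · refine hG.continuousOn.comp (continuousOn_const.div continuousOn_id fun x hx => ne_of_gt hx) ?_
      intro x hx
      exact div_pos (abs_pos.2 hj) hx
  have hconn : IsPreconnected (Set.Ioi (0 : ℝ)) := isPreconnected_Ioi
  obtain ⟨β, hβ, hβ1⟩ := hconn.intermediate_value hβ₂0 hβ₁0 hcont ⟨hup, hlow⟩
  exact ⟨β, hβ, hβ1⟩

theorem weightedOrliczNorm_zero (hG : IsOrliczFunction G CG) (w : ι → ℝ) :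
    weightedOrliczNorm G w 0 = 0 := by
  rw [weightedOrliczNorm, dif_neg]
  simp [hG.map_zero]

theorem weightedOrliczNorm_spec (hG : IsOrliczFunction G CG) (hw : ∀ i, 0 < w i)
    {v : ι → ℝ} (hv : v ≠ 0) : 0 < weightedOrliczNorm G w v ∧
      ∑ i, w i * G (|v i| / weightedOrliczNorm G w v) = 1 := by
  have h := exists_sum_mul_apply_div_eq_one hG hw hv
  rw [weightedOrliczNorm, dif_pos h]
  exact h.choose_spec

theorem weightedOrliczNorm_nonneg (hG : IsOrliczFunction G CG) (hw : ∀ i, 0 < w i) (v : ι → ℝ) :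
    0 ≤ weightedOrliczNorm G w v := by
  by_cases hv : v = 0
  · rw [hv, weightedOrliczNorm_zero hG]
  · exact (weightedOrliczNorm_spec hG hw hv).1.le

theorem weightedOrliczNorm_le_iff (hG : IsOrliczFunction G CG) (hw : ∀ i, 0 < w i) (v : ι → ℝ)
    {β : ℝ} (hβ : 0 < β) : weightedOrliczNorm G w v ≤ β ↔ ∑ i, w i * G (|v i| / β) ≤ 1 := by
  by_cases hv : v = 0
  · simp [hv, weightedOrliczNorm_zero hG, hG.map_zero, hβ.le]
  obtain ⟨hpos, hsum⟩ := weightedOrliczNorm_spec hG hw hv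
  constructor
  · intro h
    rw [← hsum]
    exact sum_mul_apply_div_antitone hG hw v hpos h
  · intro h
    by_contra! hlt
    have := sum_mul_apply_div_strictAnti hG hw hv hβ hlt
    linarith

theorem weightedOrliczNorm_eq (hG : IsOrliczFunction G CG) (hw : ∀ i, 0 < w i) {v : ι → ℝ}
    {β : ℝ} (hβ : 0 < β) (h : ∑ i, w i * G (|v i| / β) = 1) : weightedOrliczNorm G w v = β := by
  have hv : v ≠ 0 := by
    rintro rfl
    simp [hG.map_zero] at h
  obtain ⟨hpos, hsum⟩ := weightedOrliczNorm_spec hG hw hv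
  refine le_antisymm ((weightedOrliczNorm_le_iff hG hw v hβ).2 h.le) ?_
  by_contra! hlt
  have := sum_mul_apply_div_strictAnti hG hw hv hpos hlt
  linarith

theorem weightedOrliczNorm_smul (hG : IsOrliczFunction G CG) (hw : ∀ i, 0 < w i) (t : ℝ)
    (v : ι → ℝ) : weightedOrliczNorm G w (t • v) = |t| * weightedOrliczNorm G w v := by
  by_cases ht : t = 0
  · simp [ht, weightedOrliczNorm_zero hG]
  by_cases hv : v = 0
  · simp [hv, weightedOrliczNorm_zero hG]
  obtain ⟨hpos, hsum⟩ := weightedOrliczNorm_spec hG hw hv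
  have ht' : 0 < |t| := abs_pos.2 ht
  refine weightedOrliczNorm_eq hG hw (by positivity) ?_
  rw [← hsum]
  refine Finset.sum_congr rfl fun i _ => ?_
  rw [Pi.smul_apply, smul_eq_mul, abs_mul, mul_div_mul_left _ _ ht'.ne']

theorem weightedOrliczNorm_add_le (hG : IsOrliczFunction G CG) (hw : ∀ i, 0 < w i)
    (u v : ι → ℝ) :
    weightedOrliczNorm G w (u + v) ≤ weightedOrliczNorm G w u + weightedOrliczNorm G w v := by
  by_cases hu : u = 0
  · simp [hu, weightedOrliczNorm_zero hG]
  by_cases hv : v = 0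
  · simp [hv, weightedOrliczNorm_zero hG]
  obtain ⟨hs, hsu⟩ := weightedOrliczNorm_spec hG hw hu
  obtain ⟨ht, htv⟩ := weightedOrliczNorm_spec hG hw hv
  set s := weightedOrliczNorm G w u
  set t := weightedOrliczNorm G w v
  rw [weightedOrliczNorm_le_iff hG hw _ (by positivity)]
  have hterm : ∀ i, w i * G (|(u + v) i| / (s + t)) ≤
      s / (s + t) * (w i * G (|u i| / s)) + t / (s + t) * (w i * G (|v i| / t)) := by
    intro i
    have h1 : |(u + v) i| / (s + t) ≤ s / (s + t) * (|u i| / s) + t / (s + t) * (|v i| / t) := by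
      have : s / (s + t) * (|u i| / s) + t / (s + t) * (|v i| / t) = (|u i| + |v i|) / (s + t) := by
        field_simp
      rw [this]
      gcongr
      exact abs_add_le _ _
    have h2 := hG.convex.2 (show |u i| / s ∈ Set.Ici (0 : ℝ) from by
        simp only [Set.mem_Ici]; positivity)
      (show |v i| / t ∈ Set.Ici (0 : ℝ) from by simp only [Set.mem_Ici]; positivity)
      (show 0 ≤ s / (s + t) by positivity) (show 0 ≤ t / (s + t) by positivity)
      (by field_simp)
    simp only [smul_eq_mul] at h2
    have h3 := (hG.mono (by positivity) h1).trans h2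
    have := mul_le_mul_of_nonneg_left h3 (hw i).le
    linarith
  calc _ ≤ ∑ i, (s / (s + t) * (w i * G (|u i| / s)) + t / (s + t) * (w i * G (|v i| / t))) :=
        Finset.sum_le_sum fun i _ => hterm i
    _ = 1 := by
      rw [Finset.sum_add_distrib, ← Finset.mul_sum, ← Finset.mul_sum, hsu, htv]
      field_simp

/-- The weighted Orlicz norm as a seminorm. -/
def weightedOrliczSeminorm (hG : IsOrliczFunction G CG) (hw : ∀ i, 0 < w i) :
    Seminorm ℝ (ι → ℝ) :=
  Seminorm.of (weightedOrliczNorm G w) (weightedOrliczNorm_add_le hG hw)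
    (weightedOrliczNorm_smul hG hw)

theorem weightedOrliczNorm_le_of_abs_le (hG : IsOrliczFunction G CG) (hw : ∀ i, 0 < w i)
    {v : ι → ℝ} {r : ℝ} (hr : 0 ≤ r) (hv : ∀ i, |v i| ≤ r) :
    weightedOrliczNorm G w v ≤ r * (1 + (∑ i, w i) * G 1) := by
  rcases hr.eq_or_lt with rfl | hr
  · have : v = 0 := funext fun i => abs_nonpos_iff.1 (hv i)
    rw [this, weightedOrliczNorm_zero hG, zero_mul]
  set W := ∑ i, w i with hW
  have hW0 : 0 ≤ W := Finset.sum_nonneg fun i _ => (hw i).le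
  have hG1 : 0 < G 1 := hG.pos one_pos
  rw [weightedOrliczNorm_le_iff hG hw _ (by positivity)]
  have hterm : ∀ j, G (|v j| / (r * (1 + W * G 1))) ≤ 1 / (1 + W * G 1) * G 1 := by
    intro j
    have h2 : |v j| / (r * (1 + W * G 1)) ≤ 1 / (1 + W * G 1) * 1 := by
      rw [mul_one, div_le_div_iff₀ (by positivity) (by positivity)]
      have : 0 < 1 + W * G 1 := by positivity
      have := hv j
      nlinarith
    refine (hG.mono (by positivity) h2).trans (hG.mul_le (by positivity) ?_ zero_le_one)
    rw [div_le_one (by positivity)]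
    have : 0 ≤ W * G 1 := by positivity
    linarith
  calc _ ≤ ∑ i, w i * (1 / (1 + W * G 1) * G 1) :=
        Finset.sum_le_sum fun j _ => mul_le_mul_of_nonneg_left (hterm j) (hw j).le
    _ = W * G 1 / (1 + W * G 1) := by rw [← Finset.sum_mul]; ring
    _ ≤ 1 := by
      rw [div_le_one (by positivity)]; linarith

/-- Since `G 0 = 0` and `G` is convex, dividing the argument by `β` changes `G` by at least the
factor `1 / β` in the relevant direction. Hence the error passes from the sum to the norm without
any loss of constants. -/
theorem abs_weightedOrliczNorm_sub_one_le (hG : IsOrliczFunction G CG) (hw : ∀ i, 0 < w i)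
    {v : ι → ℝ} {η : ℝ} (hη : η < 1) (h : |∑ i, w i * G (v i) - 1| ≤ η) :
    |weightedOrliczNorm G w v - 1| ≤ η := by
  have hη0 : 0 ≤ η := (abs_nonneg _).trans h
  rw [abs_le] at h ⊢
  constructor
  · by_contra! hlt
    have hv : v ≠ 0 := by
      rintro rfl
      simp only [Pi.zero_apply, hG.map_zero, mul_zero, Finset.sum_const_zero] at h
      linarith
    obtain ⟨hpos, hsum⟩ := weightedOrliczNorm_spec hG hw hv
    set β := weightedOrliczNorm G w v
    have hle : (∑ i, w i * G (v i)) / β ≤ ∑ i, w i * G (|v i| / β) := by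
      rw [Finset.sum_div]
      refine Finset.sum_le_sum fun i _ => ?_
      rw [mul_div_assoc, ← hG.apply_abs (v i)]
      refine mul_le_mul_of_nonneg_left ?_ (hw i).le
      have := hG.le_mul (t := β⁻¹) ((one_le_inv₀ hpos).2 (by linarith)) (abs_nonneg (v i))
      rwa [inv_mul_eq_div, inv_mul_eq_div] at this
    rw [hsum, div_le_one hpos] at hle
    linarith
  · suffices weightedOrliczNorm G w v ≤ 1 + η by linarith
    rw [weightedOrliczNorm_le_iff hG hw _ (by positivity)]
    have hle : ∑ i, w i * G (|v i| / (1 + η)) ≤ (∑ i, w i * G (v i)) / (1 + η) := by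
      rw [Finset.sum_div]
      refine Finset.sum_le_sum fun i _ => ?_
      rw [mul_div_assoc, ← hG.apply_abs (v i)]
      refine mul_le_mul_of_nonneg_left ?_ (hw i).le
      have := hG.mul_le (t := (1 + η)⁻¹) (by positivity)
        (inv_le_one_of_one_le₀ (by linarith)) (abs_nonneg (v i))
      rwa [inv_mul_eq_div, inv_mul_eq_div] at this
    refine hle.trans ?_
    rw [div_le_one (by positivity)]
    linarith

/-- Needed qualitatively: it makes suprema over the Orlicz sphere finite and bounds the sample norm
by some multiple of the true norm. -/
theorem abs_apply_le_mul_orliczNorm (hG : IsOrliczFunction G CG) (v : ι → ℝ) (i : ι) :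
    |v i| ≤ (1 + 1 / G 1) * orliczNorm G v := by
  have hw : ∀ i : ι, 0 < (fun _ : ι => (1 : ℝ)) i := fun _ => one_pos
  by_cases hv : v = 0
  · simp [hv, orliczNorm, weightedOrliczNorm_zero hG]
  obtain ⟨hpos, hsum⟩ := weightedOrliczNorm_spec hG hw hv
  change _ ≤ _ * weightedOrliczNorm G (fun _ => 1) v
  set β := weightedOrliczNorm G (fun _ : ι => 1) v
  have hG1 : 0 < G 1 := hG.pos one_pos
  by_contra! hlt
  rw [← lt_div_iff₀ hpos] at hlt
  have h1 : 0 < 1 / G 1 := by positivity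
  have h2 := hG.lt (by positivity) hlt
  have h3 := hG.le_mul (t := 1 + 1 / G 1) (by linarith) zero_le_one
  rw [mul_one, add_mul, one_div_mul_cancel hG1.ne'] at h3
  have h4 : G (|v i| / β) ≤ ∑ i, 1 * G (|v i| / β) := by
    simp only [one_mul]
    exact Finset.single_le_sum (f := fun i => G (|v i| / β)) (fun j _ => hG.nonneg _)
      (Finset.mem_univ i)
  linarith

theorem sum_apply_eq_one_of_orliczNorm_eq_one (hG : IsOrliczFunction G CG) {v : ι → ℝ}
    (hv : orliczNorm G v = 1) : ∑ i, G (v i) = 1 := by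
  have hw : ∀ i : ι, 0 < (fun _ : ι => (1 : ℝ)) i := fun _ => one_pos
  have hv0 : v ≠ 0 := by
    rintro rfl
    rw [orliczNorm, weightedOrliczNorm_zero hG] at hv
    exact zero_ne_one hv
  have h := (weightedOrliczNorm_spec hG hw hv0).2
  rw [show weightedOrliczNorm G (fun _ => 1) v = 1 from hv] at h
  simpa [hG.apply_abs] using h

end WeightedNorm

/-! ### From `L₁` sensitivities to Orlicz sensitivities -/

section Net

variable {G : ℝ → ℝ} {CG : ℝ} {n d : ℕ} {A : Matrix (Fin n) (Fin d) ℝ}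

/-- The seminorm `x ↦ ‖A x‖_G`. -/
def orliczSeminorm (hG : IsOrliczFunction G CG) (A : Matrix (Fin n) (Fin d) ℝ) :
    Seminorm ℝ (Fin d → ℝ) :=
  (weightedOrliczSeminorm hG (w := fun _ : Fin n => 1) fun _ => one_pos).comp A.mulVecLin

theorem orliczSeminorm_apply (hG : IsOrliczFunction G CG) (A : Matrix (Fin n) (Fin d) ℝ)
    (x : Fin d → ℝ) : orliczSeminorm hG A x = orliczNorm G (A *ᵥ x) := rfl

theorem exists_orliczNorm_mulVec_eq_one (hG : IsOrliczFunction G CG) (hA : A ≠ 0) :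
    ∃ z, orliczNorm G (A *ᵥ z) = 1 := by
  have : ∃ z, A *ᵥ z ≠ 0 := by
    by_contra! h
    exact hA (Matrix.ext_of_mulVec_single fun j => by rw [h, Matrix.zero_mulVec])
  obtain ⟨z, hz⟩ := this
  have hpos := (weightedOrliczNorm_spec hG (w := fun _ : Fin n => 1) (fun _ => one_pos) hz).1
  change 0 < orliczNorm G (A *ᵥ z) at hpos
  refine ⟨(orliczNorm G (A *ᵥ z))⁻¹ • z, ?_⟩
  rw [← orliczSeminorm_apply hG, map_smul_eq_mul, orliczSeminorm_apply,
    Real.norm_of_nonneg (by positivity), inv_mul_cancel₀ hpos.ne']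

/-- A nonzero matrix forces a net point with a nonzero inner product, so `Δ₁ ≤ Δ₂`; then `G t / t`
is monotone. -/
theorem one_le_of_isOrliczNet (hG : IsOrliczFunction G CG) (hA : A ≠ 0) {ε : ℝ}
    {N : Set (Fin d → ℝ)} (hN : IsOrliczNet G A ε N) {Δ₁ Δ₂ : ℝ} (h1 : 0 < Δ₁) (h2 : 0 < Δ₂)
    (hΔ : ∀ x ∈ N, ∀ j, A j ⬝ᵥ x ≠ 0 → Δ₁ ≤ |A j ⬝ᵥ x| ∧ |A j ⬝ᵥ x| ≤ Δ₂) :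
    1 ≤ (G Δ₂ * Δ₁) / (G Δ₁ * Δ₂) := by
  obtain ⟨z, hz⟩ := exists_orliczNorm_mulVec_eq_one hG hA
  obtain ⟨x, hx, -⟩ := hN.2 z hz
  have hx1 := hN.1 x hx
  have hne : A *ᵥ x ≠ 0 := by
    intro h
    rw [h, orliczNorm, weightedOrliczNorm_zero hG] at hx1
    exact zero_ne_one hx1
  obtain ⟨j, hj⟩ := Function.ne_iff.1 hne
  have hj' := hΔ x hx j hj
  have h := hG.div_le_div h1 (hj'.1.trans hj'.2)
  have hG1 := hG.pos h1
  rw [div_le_div_iff₀ h1 h2] at h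
  rwa [one_le_div (by positivity)]

/-- On net points `G t ≤ (G Δ₂ / Δ₂) t` for the row at hand and `t ≤ (Δ₁ / G Δ₁) G t` for every row
turn the `L₁` bound into an Orlicz bound. Off the net, the largest inner product on the sphere is
within a factor 4 of one on the net, and the growth condition pays for that factor. -/
theorem apply_le_mul_of_isOrliczNet (hG : IsOrliczFunction G CG) {ε : ℝ} (hε : ε < 1 / 2)
    {N : Set (Fin d → ℝ)} (hN : IsOrliczNet G A ε N) {Δ₁ Δ₂ : ℝ} (h1 : 0 < Δ₁) (h2 : 0 < Δ₂)
    (hΔ : ∀ x ∈ N, ∀ j, A j ⬝ᵥ x ≠ 0 → Δ₁ ≤ |A j ⬝ᵥ x| ∧ |A j ⬝ᵥ x| ≤ Δ₂) {s : ℝ} (hs : 0 ≤ s)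
    {i : Fin n} (hi : ∀ x, |A i ⬝ᵥ x| ≤ s * ∑ j, |A j ⬝ᵥ x|) {z : Fin d → ℝ}
    (hz : orliczNorm G (A *ᵥ z) = 1) :
    G (A i ⬝ᵥ z) ≤ 16 * max CG 1 * ((G Δ₂ * Δ₁) / (G Δ₁ * Δ₂) * s) := by
  have hG1 := hG.pos h1
  have hG2 := hG.pos h2
  have hnet : ∀ x ∈ N, G (A i ⬝ᵥ x) ≤ (G Δ₂ * Δ₁) / (G Δ₁ * Δ₂) * s := by
    intro x hx
    have hsum : ∑ j, G (A j ⬝ᵥ x) = 1 := sum_apply_eq_one_of_orliczNorm_eq_one hG (hN.1 x hx)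
    have hup : G (A i ⬝ᵥ x) ≤ G Δ₂ / Δ₂ * |A i ⬝ᵥ x| := by
      by_cases h0 : A i ⬝ᵥ x = 0
      · simp [h0, hG.map_zero]
      · have hpos : 0 < |A i ⬝ᵥ x| := abs_pos.2 h0
        have := hG.div_le_div hpos (hΔ x hx i h0).2
        rwa [hG.apply_abs, div_le_iff₀ hpos] at this
    have hlow : ∀ j, |A j ⬝ᵥ x| ≤ Δ₁ / G Δ₁ * G (A j ⬝ᵥ x) := by
      intro j
      by_cases h0 : A j ⬝ᵥ x = 0
      · simp [h0, hG.map_zero]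
      · have hpos : 0 < |A j ⬝ᵥ x| := abs_pos.2 h0
        have := hG.div_le_div h1 (hΔ x hx j h0).1
        rw [hG.apply_abs, div_le_div_iff₀ h1 hpos] at this
        rw [div_mul_eq_mul_div, le_div_iff₀ hG1]
        linarith
    have hl1 : ∑ j, |A j ⬝ᵥ x| ≤ Δ₁ / G Δ₁ := by
      calc ∑ j, |A j ⬝ᵥ x| ≤ ∑ j, Δ₁ / G Δ₁ * G (A j ⬝ᵥ x) := Finset.sum_le_sum fun j _ => hlow j
        _ = Δ₁ / G Δ₁ := by rw [← Finset.mul_sum, hsum, mul_one]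
    calc G (A i ⬝ᵥ x) ≤ G Δ₂ / Δ₂ * |A i ⬝ᵥ x| := hup
      _ ≤ G Δ₂ / Δ₂ * (s * (Δ₁ / G Δ₁)) := by
        refine mul_le_mul_of_nonneg_left ((hi x).trans ?_) (by positivity)
        exact mul_le_mul_of_nonneg_left hl1 hs
      _ = _ := by field_simp
  have hmul : ∀ y, (A *ᵥ y) i = A i ⬝ᵥ y := fun y => rfl
  set S : Set ℝ := {t | ∃ z, orliczNorm G (A *ᵥ z) = 1 ∧ t = |A i ⬝ᵥ z|}
  have hbdd : BddAbove S := ⟨1 + 1 / G 1, by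
    rintro _ ⟨y, hy, rfl⟩
    have := abs_apply_le_mul_orliczNorm hG (A *ᵥ y) i
    rwa [hy, mul_one, hmul] at this⟩
  set T := sSup S with hT
  have hTz : |A i ⬝ᵥ z| ≤ T := le_csSup hbdd ⟨z, hz, rfl⟩
  have hT0 : 0 ≤ T := (abs_nonneg _).trans hTz
  have hTall : ∀ y, |A i ⬝ᵥ y| ≤ T * orliczNorm G (A *ᵥ y) := by
    intro y
    have hT' := abs_apply_le_mul_orliczNorm hG (A *ᵥ y) i
    rw [← orliczSeminorm_apply hG] at hT' ⊢
    rcases (apply_nonneg (orliczSeminorm hG A) y).eq_or_lt with h0 | hpos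
    · rw [← h0] at hT' ⊢
      rwa [mul_zero] at hT' ⊢
    · have hy1 : orliczSeminorm hG A ((orliczSeminorm hG A y)⁻¹ • y) = 1 := by
        rw [map_smul_eq_mul, Real.norm_of_nonneg (by positivity), inv_mul_cancel₀ hpos.ne']
      have hle : |A i ⬝ᵥ ((orliczSeminorm hG A y)⁻¹ • y)| ≤ T := le_csSup hbdd ⟨_, hy1, rfl⟩
      rw [dotProduct_smul, smul_eq_mul, abs_mul, abs_of_pos (inv_pos.2 hpos),
        inv_mul_le_iff₀ hpos] at hle
      linarith
  rcases hT0.eq_or_lt with h0 | hpos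
  · rw [← h0] at hTz
    rw [abs_nonpos_iff.1 hTz, hG.map_zero]
    positivity
  -- Passing from `y` to a net point loses at most `T * ε ≤ T / 2`, so starting from `3 / 4 * T`
  -- leaves `T / 4`.
  obtain ⟨_, ⟨y, hy, rfl⟩, hyT⟩ := exists_lt_of_lt_csSup (s := S) ⟨_, z, hz, rfl⟩
    (show 3 / 4 * T < sSup S by rw [← hT]; linarith)
  obtain ⟨x, hx, hyx⟩ := hN.2 y hy
  have hle : T ≤ 4 * |A i ⬝ᵥ x| := by
    rw [← Matrix.mulVec_sub] at hyx
    have h3 := (hTall (y - x)).trans (mul_le_mul_of_nonneg_left hyx hpos.le)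
    have h4 : T * ε ≤ T * (1 / 2) := mul_le_mul_of_nonneg_left hε.le hpos.le
    rw [dotProduct_sub] at h3
    have h5 := abs_sub_abs_le_abs_sub (A i ⬝ᵥ y) (A i ⬝ᵥ x)
    linarith
  calc G (A i ⬝ᵥ z) = G |A i ⬝ᵥ z| := (hG.apply_abs _).symm
    _ ≤ G (4 * |A i ⬝ᵥ x|) := hG.mono (abs_nonneg _) (hTz.trans hle)
    _ ≤ 16 * max CG 1 * G |A i ⬝ᵥ x| := hG.apply_four_mul_le (abs_nonneg _)
    _ ≤ _ := by
      rw [hG.apply_abs]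
      exact mul_le_mul_of_nonneg_left (hnet x hx) (by positivity)

end Net

/-! ### Online Lewis weights -/

section LewisWeights

variable {d : ℕ}

theorem det_add_smul_vecMulVec {Q : Matrix (Fin d) (Fin d) ℝ} (hQ : Q.PosDef) (a : Fin d → ℝ)
    (t : ℝ) : (Q + t • Matrix.vecMulVec a a).det = Q.det * (1 + t * (a ⬝ᵥ Q⁻¹ *ᵥ a)) := by
  have hdet : IsUnit Q.det := (Matrix.isUnit_iff_isUnit_det _).1 hQ.isUnit
  rw [← Matrix.smul_vecMulVec, Matrix.vecMulVec_eq Unit,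
    Matrix.det_add_replicateCol_mul_replicateRow hdet, Matrix.det_unique (n := Unit)]
  congr 1
  rw [Matrix.add_apply, Matrix.one_apply_eq, Matrix.mul_assoc, ← Matrix.replicateCol_mulVec,
    Matrix.replicateRow_mul_replicateCol_apply, Matrix.mulVec_smul, dotProduct_smul, smul_eq_mul]

theorem sq_dotProduct_le_of_posDef {Q : Matrix (Fin d) (Fin d) ℝ} (hQ : Q.PosDef)
    (a x : Fin d → ℝ) : (a ⬝ᵥ x) ^ 2 ≤ (a ⬝ᵥ Q⁻¹ *ᵥ a) * (x ⬝ᵥ Q *ᵥ x) := by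
  have hdet : IsUnit Q.det := (Matrix.isUnit_iff_isUnit_det _).1 hQ.isUnit
  by_cases ha : a = 0
  · simp [ha]
  have hu : 0 < a ⬝ᵥ Q⁻¹ *ᵥ a := by simpa using hQ.inv.dotProduct_mulVec_pos ha
  set u := a ⬝ᵥ Q⁻¹ *ᵥ a with hu_def
  set y := Q⁻¹ *ᵥ a with hy
  have hQy : Q *ᵥ y = a := by
    rw [hy, Matrix.mulVec_mulVec, Matrix.mul_nonsing_inv _ hdet, Matrix.one_mulVec]
  have hsymm : Qᵀ = Q := by simpa using hQ.1.eq
  have hyQ : ∀ z, y ⬝ᵥ Q *ᵥ z = a ⬝ᵥ z := by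
    intro z
    rw [Matrix.dotProduct_mulVec, ← Matrix.mulVec_transpose, hsymm, hQy]
  set t := (a ⬝ᵥ x) / u with ht
  have hnn : 0 ≤ (x - t • y) ⬝ᵥ Q *ᵥ (x - t • y) := by
    simpa using hQ.posSemidef.dotProduct_mulVec_nonneg (x - t • y)
  have hexp : (x - t • y) ⬝ᵥ Q *ᵥ (x - t • y) =
      x ⬝ᵥ Q *ᵥ x - 2 * t * (a ⬝ᵥ x) + t ^ 2 * u := by
    rw [Matrix.mulVec_sub, Matrix.mulVec_smul, hQy, sub_dotProduct, dotProduct_sub, dotProduct_sub,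
      smul_dotProduct, smul_dotProduct, dotProduct_smul, dotProduct_smul, hyQ, dotProduct_comm y a,
      dotProduct_comm x a]
    simp only [smul_eq_mul]
    ring
  rw [hexp] at hnn
  have h2 : x ⬝ᵥ Q *ᵥ x - 2 * t * (a ⬝ᵥ x) + t ^ 2 * u = x ⬝ᵥ Q *ᵥ x - (a ⬝ᵥ x) ^ 2 / u := by
    rw [ht]; field_simp; ring
  rw [h2, sub_nonneg, div_le_iff₀ hu] at hnn
  linarith

/-- Take `R = Q + w⁻¹ a aᵀ` with `aᵀ R⁻¹ a = w²`. By Sherman–Morrison this means `w² = u (1 - w)`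
for `u = aᵀ Q⁻¹ a`, and the determinant then grows by `1 + u / w = (1 - w)⁻¹ ≥ exp w`. The increment
of the quadratic form is at most `|⟨a, x⟩|` times the new norm, so the norm itself grows by at most
`|⟨a, x⟩|`. -/
theorem exists_online_lewis_weight {Q : Matrix (Fin d) (Fin d) ℝ} (hQ : Q.PosDef)
    (a : Fin d → ℝ) : ∃ (w : ℝ) (R : Matrix (Fin d) (Fin d) ℝ), 0 ≤ w ∧ w ≤ 1 ∧ R.PosDef ∧
      Real.exp w * Q.det ≤ R.det ∧ (∀ x, |a ⬝ᵥ x| ≤ w * √(x ⬝ᵥ R *ᵥ x)) ∧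
      ∀ x, √(x ⬝ᵥ R *ᵥ x) ≤ √(x ⬝ᵥ Q *ᵥ x) + |a ⬝ᵥ x| := by
  by_cases ha : a = 0
  · exact ⟨0, Q, le_rfl, zero_le_one, hQ, by simp, by simp [ha], by simp [ha]⟩
  have hu : 0 < a ⬝ᵥ Q⁻¹ *ᵥ a := by simpa using hQ.inv.dotProduct_mulVec_pos ha
  set u := a ⬝ᵥ Q⁻¹ *ᵥ a with hu_def
  -- The positive root of `w² + u w - u`.
  obtain ⟨w, hw0, hw⟩ : ∃ w : ℝ, 0 < w ∧ w ^ 2 = u * (1 - w) := by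
    have hs := Real.sq_sqrt (show 0 ≤ u ^ 2 + 4 * u by positivity)
    refine ⟨(-u + √(u ^ 2 + 4 * u)) / 2, ?_, ?_⟩
    · have : u < √(u ^ 2 + 4 * u) := Real.lt_sqrt_of_sq_lt (by linarith)
      linarith
    · nlinarith
  have hw1 : w < 1 := by
    by_contra! h
    have : u * (1 - w) ≤ 0 := mul_nonpos_of_nonneg_of_nonpos hu.le (by linarith)
    have : 0 < w ^ 2 := by positivity
    linarith
  have hquad : ∀ x, x ⬝ᵥ (Q + w⁻¹ • Matrix.vecMulVec a a) *ᵥ x =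
      x ⬝ᵥ Q *ᵥ x + (a ⬝ᵥ x) ^ 2 / w := by
    intro x
    rw [Matrix.add_mulVec, dotProduct_add, Matrix.smul_mulVec, Matrix.vecMulVec_mulVec,
      dotProduct_smul, dotProduct_smul, dotProduct_comm x a]
    simp only [smul_eq_mul, MulOpposite.smul_eq_mul_unop, MulOpposite.unop_op]
    ring
  have hQnn : ∀ x, 0 ≤ x ⬝ᵥ Q *ᵥ x := fun x => by
    simpa using hQ.posSemidef.dotProduct_mulVec_nonneg x
  have hlev : ∀ x, |a ⬝ᵥ x| ≤ w * √(x ⬝ᵥ (Q + w⁻¹ • Matrix.vecMulVec a a) *ᵥ x) := by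
    intro x
    have hsq : ∀ y, w * √y = √(w ^ 2 * y) := fun y => by
      rw [Real.sqrt_mul (sq_nonneg w), Real.sqrt_sq hw0.le]
    rw [hsq, hquad]
    apply Real.le_sqrt_of_sq_le
    rw [sq_abs]
    have h1 := mul_le_mul_of_nonneg_right (sq_dotProduct_le_of_posDef hQ a x)
      (show 0 ≤ 1 - w by linarith)
    have h2 : w ^ 2 * (x ⬝ᵥ Q *ᵥ x + (a ⬝ᵥ x) ^ 2 / w) =
        u * (1 - w) * (x ⬝ᵥ Q *ᵥ x) + w * (a ⬝ᵥ x) ^ 2 := by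
      rw [mul_add, hw]; congr 1; rw [← hw]; field_simp
    rw [h2]
    nlinarith
  refine ⟨w, Q + w⁻¹ • Matrix.vecMulVec a a, hw0.le, hw1.le, ?_, ?_, hlev, ?_⟩
  · have := Matrix.posSemidef_vecMulVec_self_star a
    rw [star_trivial] at this
    exact hQ.add_posSemidef (this.smul (inv_nonneg.2 hw0.le))
  · rw [det_add_smul_vecMulVec hQ, mul_comm]
    refine mul_le_mul_of_nonneg_left ?_ hQ.det_pos.le
    have h1w : 0 < 1 - w := by linarith
    have h1 : 1 + w⁻¹ * u = (1 - w)⁻¹ := by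
      field_simp
      nlinarith
    rw [← hu_def, h1, ← inv_inv (Real.exp w), ← Real.exp_neg]
    apply inv_anti₀ h1w
    have := Real.add_one_le_exp (-w)
    linarith
  · intro x
    have hR := hlev x
    have hRsq := (Real.sq_sqrt (show 0 ≤ x ⬝ᵥ (Q + w⁻¹ • Matrix.vecMulVec a a) *ᵥ x by
      rw [hquad]; have := hQnn x; positivity)).trans (hquad x)
    have hQsq := Real.sq_sqrt (hQnn x)
    have hR0 := Real.sqrt_nonneg (x ⬝ᵥ (Q + w⁻¹ • Matrix.vecMulVec a a) *ᵥ x)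
    have hle : √(x ⬝ᵥ Q *ᵥ x) ≤ √(x ⬝ᵥ (Q + w⁻¹ • Matrix.vecMulVec a a) *ᵥ x) := by
      apply Real.sqrt_le_sqrt
      rw [hquad]
      have : 0 ≤ (a ⬝ᵥ x) ^ 2 / w := by positivity
      linarith
    set q := √(x ⬝ᵥ Q *ᵥ x)
    set r := √(x ⬝ᵥ (Q + w⁻¹ • Matrix.vecMulVec a a) *ᵥ x)
    have h3 : (a ⬝ᵥ x) ^ 2 / w ≤ |a ⬝ᵥ x| * r := by
      rw [div_le_iff₀ hw0, ← sq_abs, sq]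
      have := mul_le_mul_of_nonneg_left hR (abs_nonneg (a ⬝ᵥ x))
      linarith
    rcases hR0.eq_or_lt with h0 | hpos
    · rw [← h0]
      have := Real.sqrt_nonneg (x ⬝ᵥ Q *ᵥ x)
      positivity
    · have hq0 : 0 ≤ q := Real.sqrt_nonneg _
      have h4 : r * r ≤ (q + |a ⬝ᵥ x|) * r := by nlinarith
      exact le_of_mul_le_mul_right h4 hpos

theorem det_le_pow_of_posDef {Q : Matrix (Fin d) (Fin d) ℝ} (hQ : Q.PosDef) {B : ℝ}
    (hB : ∀ x, x ⬝ᵥ Q *ᵥ x ≤ B * (x ⬝ᵥ x)) : Q.det ≤ B ^ d := by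
  rw [hQ.1.det_eq_prod_eigenvalues]
  calc ∏ i, ((hQ.1.eigenvalues i : ℝ) : ℝ) ≤ ∏ _i : Fin d, B := by
        refine Finset.prod_le_prod (fun i _ => (hQ.eigenvalues_pos i).le) fun i _ => ?_
        have h := hB (hQ.1.eigenvectorBasis i).ofLp
        rw [hQ.1.mulVec_eigenvectorBasis, dotProduct_smul, smul_eq_mul] at h
        refine le_of_mul_le_mul_right h ?_
        have hne : (hQ.1.eigenvectorBasis i).ofLp ≠ 0 := by
          intro h0
          have h1 := (hQ.1.eigenvectorBasis.orthonormal.1 i)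
          have h2 : hQ.1.eigenvectorBasis i = 0 := by
            ext j; exact congrFun h0 j
          rw [h2, norm_zero] at h1
          exact zero_ne_one h1
        simpa using Matrix.dotProduct_star_self_pos_iff.2 hne
    _ = B ^ d := by simp

/-- Iterate from `Q = l² I`. The norm increments telescope to the regularised prefix `L₁` norm, so a
bound relative to `Q` is one relative to that norm; the determinant factors multiply to the
exponential of the sum of the weights. -/
theorem exists_online_lewis_weights (a : ℕ → Fin d → ℝ) {l : ℝ} (hl : 0 < l) (k : ℕ) :
    ∃ (w : ℕ → ℝ) (Q : Matrix (Fin d) (Fin d) ℝ), Q.PosDef ∧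
      (∀ i < k, 0 ≤ w i ∧ w i ≤ 1 ∧ ∀ x, |a i ⬝ᵥ x| ≤
        w i * (l * √(x ⬝ᵥ x) + ∑ j ∈ Finset.range (i + 1), |a j ⬝ᵥ x|)) ∧
      (∀ x, √(x ⬝ᵥ Q *ᵥ x) ≤ l * √(x ⬝ᵥ x) + ∑ j ∈ Finset.range k, |a j ⬝ᵥ x|) ∧
      Real.exp (∑ i ∈ Finset.range k, w i) * (l ^ 2) ^ d ≤ Q.det := by
  induction k with
  | zero =>
    refine ⟨0, l ^ 2 • (1 : Matrix (Fin d) (Fin d) ℝ), Matrix.PosDef.one.smul (by positivity),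
      by simp, ?_, by simp⟩
    intro x
    rw [Matrix.smul_mulVec, Matrix.one_mulVec, dotProduct_smul, smul_eq_mul,
      Real.sqrt_mul (sq_nonneg l), Real.sqrt_sq hl.le]
    simp
  | succ k ih =>
    obtain ⟨w, Q, hQ, hw, hQx, hdet⟩ := ih
    obtain ⟨v, R, hv0, hv1, hR, hRdet, hlev, hRx⟩ := exists_online_lewis_weight hQ (a k)
    have hRx' : ∀ x, √(x ⬝ᵥ R *ᵥ x) ≤
        l * √(x ⬝ᵥ x) + ∑ j ∈ Finset.range (k + 1), |a j ⬝ᵥ x| := by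
      intro x
      rw [Finset.sum_range_succ]
      have := hRx x
      have := hQx x
      linarith
    refine ⟨Function.update w k v, R, hR, ?_, hRx', ?_⟩
    · intro i hi
      rcases (Nat.lt_succ_iff_lt_or_eq.1 hi) with hi | rfl
      · rw [Function.update_of_ne hi.ne]
        exact hw i hi
      · rw [Function.update_self]
        exact ⟨hv0, hv1, fun x => (hlev x).trans (mul_le_mul_of_nonneg_left (hRx' x) hv0)⟩
    · have hsum : ∑ i ∈ Finset.range (k + 1), Function.update w k v i =
          ∑ i ∈ Finset.range k, w i + v := by
        rw [Finset.sum_range_succ, Function.update_self]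
        congr 1
        exact Finset.sum_congr rfl fun i hi =>
          Function.update_of_ne (Finset.mem_range.1 hi).ne _ _
      rw [hsum, add_comm, Real.exp_add, mul_assoc]
      exact (mul_le_mul_of_nonneg_left hdet (Real.exp_nonneg v)).trans hRdet

theorem sum_le_of_exp_mul_le_det {Q : Matrix (Fin d) (Fin d) ℝ} (hQ : Q.PosDef) {l L s : ℝ}
    (hl : 0 < l) (hL : 0 ≤ L) (hQx : ∀ x, √(x ⬝ᵥ Q *ᵥ x) ≤ (l + L) * √(x ⬝ᵥ x))
    (hs : Real.exp s * (l ^ 2) ^ d ≤ Q.det) : s ≤ 2 * d * Real.log ((l + L) / l) := by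
  have hdet : Q.det ≤ ((l + L) ^ 2) ^ d := by
    refine det_le_pow_of_posDef hQ fun x => ?_
    have hxx : 0 ≤ x ⬝ᵥ x := by simpa using dotProduct_star_self_nonneg x
    have h := hQx x
    rw [← Real.sqrt_sq (show 0 ≤ l + L by positivity), ← Real.sqrt_mul (sq_nonneg _)] at h
    exact (Real.sqrt_le_sqrt_iff (by positivity)).1 h
  have h1 : Real.exp s ≤ ((l + L) / l) ^ (2 * d) := by
    rw [div_pow, le_div_iff₀ (by positivity), pow_mul, pow_mul]
    exact hs.trans hdet
  have h2 := Real.log_le_log (Real.exp_pos s) h1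
  rw [Real.log_exp, Real.log_pow] at h2
  push_cast at h2
  exact h2

end LewisWeights

/-! ### Extreme singular values -/

section SingularValues

variable {E F : Type*} [NormedAddCommGroup E] [InnerProductSpace ℝ E] [FiniteDimensional ℝ E]
  [NormedAddCommGroup F] [InnerProductSpace ℝ F] [FiniteDimensional ℝ F]

theorem sq_norm_apply_eq_sum_sq_singularValues (T : E →ₗ[ℝ] F) (x : E) :
    ‖T x‖ ^ 2 = ∑ i : Fin (Module.finrank ℝ E), T.singularValues i ^ 2 *
      ‖inner ℝ (T.isSymmetric_adjoint_comp_self.eigenvectorBasis rfl i) x‖ ^ 2 := by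
  set b := T.isSymmetric_adjoint_comp_self.eigenvectorBasis rfl with hb
  have h1 : ‖T x‖ ^ 2 = inner ℝ ((LinearMap.adjoint T ∘ₗ T) x) x := by
    rw [LinearMap.comp_apply, LinearMap.adjoint_inner_left, real_inner_self_eq_norm_sq]
  rw [h1, ← b.sum_inner_mul_inner]
  refine Finset.sum_congr rfl fun i _ => ?_
  rw [T.isSymmetric_adjoint_comp_self x (b i), hb,
    T.isSymmetric_adjoint_comp_self.apply_eigenvectorBasis, ← hb, inner_smul_right,
    T.sq_singularValues_fin rfl i, real_inner_comm x, Real.norm_eq_abs, sq_abs]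
  simp only [RCLike.ofReal_real_eq_id, id_eq]
  ring

theorem norm_apply_le_singularValues_zero_mul (T : E →ₗ[ℝ] F) (x : E) :
    ‖T x‖ ≤ T.singularValues 0 * ‖x‖ := by
  have hσ := T.singularValues_nonneg 0
  refine le_of_sq_le_sq ?_ (by positivity)
  rw [sq_norm_apply_eq_sum_sq_singularValues, mul_pow,
    ← (T.isSymmetric_adjoint_comp_self.eigenvectorBasis rfl).sum_sq_norm_inner_right x,
    Finset.mul_sum]
  refine Finset.sum_le_sum fun i _ => mul_le_mul_of_nonneg_right ?_ (by positivity)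
  exact pow_le_pow_left₀ (T.singularValues_nonneg _) (T.singularValues_antitone (Nat.zero_le _)) 2

theorem singularValues_finrank_range_sub_one_mul_le (T : E →ₗ[ℝ] F) {x : E} (hx : x ∈ T.kerᗮ) :
    T.singularValues (Module.finrank ℝ T.range - 1) * ‖x‖ ≤ ‖T x‖ := by
  refine le_of_sq_le_sq ?_ (norm_nonneg _)
  rw [sq_norm_apply_eq_sum_sq_singularValues, mul_pow,
    ← (T.isSymmetric_adjoint_comp_self.eigenvectorBasis rfl).sum_sq_norm_inner_right x,
    Finset.mul_sum]
  refine Finset.sum_le_sum fun i _ => ?_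
  by_cases hi : (i : ℕ) < Module.finrank ℝ T.range
  · refine mul_le_mul_of_nonneg_right ?_ (by positivity)
    exact pow_le_pow_left₀ (T.singularValues_nonneg _)
      (T.singularValues_antitone (by omega)) 2
  · have h0 : T.singularValues i = 0 :=
      T.singularValues_eq_zero_iff_le_finrank_range.2 (not_lt.1 hi)
    set b := T.isSymmetric_adjoint_comp_self.eigenvectorBasis rfl with hb
    have hker : b i ∈ T.ker := by
      rw [LinearMap.mem_ker, ← norm_eq_zero, ← sq_eq_zero_iff]
      have h1 : ‖T (b i)‖ ^ 2 = inner ℝ ((LinearMap.adjoint T ∘ₗ T) (b i)) (b i) := by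
        rw [LinearMap.comp_apply, LinearMap.adjoint_inner_left, real_inner_self_eq_norm_sq]
      rw [h1, hb, T.isSymmetric_adjoint_comp_self.apply_eigenvectorBasis,
        ← T.sq_singularValues_fin rfl i, h0]
      simp
    have hin : inner ℝ (b i) x = 0 := hx _ hker
    rw [hin]
    simp

end SingularValues

/-! ### Short preimages for integer matrices -/

section ConditionNumber

variable {m : Type*} [Fintype m] {d : ℕ}

theorem norm_toLp_eq_sqrt_dotProduct {ι : Type*} [Fintype ι] (x : ι → ℝ) :
    ‖WithLp.toLp 2 x‖ = √(x ⬝ᵥ x) := by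
  rw [EuclideanSpace.norm_eq]
  simp [dotProduct, sq]

/-- A nonzero integer entry makes the largest singular value at least 1, hence the smallest nonzero
one at least `1 / κ`. The witness is the component of `x` orthogonal to the kernel. -/
theorem exists_mulVec_eq_and_sqrt_le (B : Matrix m (Fin d) ℝ)
    (hB : ∀ i j, ∃ z : ℤ, B i j = z) {κ : ℝ} (hκ : conditionNumber B ≤ κ) (x : Fin d → ℝ) :
    ∃ y, B *ᵥ y = B *ᵥ x ∧ √(y ⬝ᵥ y) ≤ κ * √((B *ᵥ x) ⬝ᵥ (B *ᵥ x)) := by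
  by_cases hB0 : B = 0
  · exact ⟨0, by simp [hB0], by simp [hB0]⟩
  set T := Matrix.toLpLin 2 2 B with hT
  have hTapply : ∀ v, T (WithLp.toLp 2 v) = WithLp.toLp 2 (B *ᵥ v) := fun v => by
    rw [hT, Matrix.toLpLin_apply]
  have hrank : B.rank = Module.finrank ℝ T.range := by
    rw [hT, Matrix.rank_eq_finrank_range_toLin B (PiLp.basisFun 2 ℝ m) (PiLp.basisFun 2 ℝ (Fin d)),
      Matrix.toLpLin_eq_toLin]
  have hσ0 : 1 ≤ T.singularValues 0 := by
    obtain ⟨i, j, hij⟩ : ∃ i j, B i j ≠ 0 := by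
      by_contra! h
      exact hB0 (Matrix.ext h)
    obtain ⟨z, hz⟩ := hB i j
    have hz1 : 1 ≤ |B i j| := by
      rw [hz] at hij ⊢
      have : z ≠ 0 := by exact_mod_cast hij
      exact_mod_cast Int.one_le_abs this
    have h := norm_apply_le_singularValues_zero_mul T (EuclideanSpace.single j 1)
    rw [PiLp.norm_single, norm_one, mul_one] at h
    refine (hz1.trans ?_).trans h
    have h2 := PiLp.norm_apply_le (T (EuclideanSpace.single j 1)) i
    have h3 : T (EuclideanSpace.single j 1) i = B i j := by
      rw [hT, Matrix.toLpLin_apply]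
      simp [EuclideanSpace.single]
    rwa [h3] at h2
  have hTne : 0 < Module.finrank ℝ T.range := by
    rw [← T.singularValues_pos_iff_lt_finrank_range]
    linarith
  have hσr : 0 < T.singularValues (B.rank - 1) := by
    rw [hrank, T.singularValues_pos_iff_lt_finrank_range]
    omega
  have hκσ : 1 ≤ κ * T.singularValues (B.rank - 1) := by
    rw [conditionNumber, div_le_iff₀ hσr] at hκ
    exact hσ0.trans hκ
  obtain ⟨u, hu, v, hv, huv⟩ :=
    Submodule.exists_add_mem_mem_orthogonal (K := T.ker) (WithLp.toLp 2 x)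
  have hTv : T v = WithLp.toLp 2 (B *ᵥ x) := by
    rw [← hTapply, huv, map_add, LinearMap.mem_ker.1 hu, zero_add]
  refine ⟨v.ofLp, ?_, ?_⟩
  · have := hTapply v.ofLp
    rw [WithLp.toLp_ofLp, hTv] at this
    exact (WithLp.toLp_injective 2 this).symm
  · have h := singularValues_finrank_range_sub_one_mul_le T hv
    rw [← hrank, hTv, norm_toLp_eq_sqrt_dotProduct (B *ᵥ x)] at h
    rw [← norm_toLp_eq_sqrt_dotProduct v.ofLp, WithLp.toLp_ofLp]
    have hκ0 : 0 < κ := by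
      by_contra! hneg
      have := mul_nonpos_of_nonpos_of_nonneg hneg hσr.le
      linarith
    calc ‖v‖ ≤ κ * T.singularValues (B.rank - 1) * ‖v‖ := le_mul_of_one_le_left (norm_nonneg _) hκσ
      _ = κ * (T.singularValues (B.rank - 1) * ‖v‖) := by ring
      _ ≤ _ := mul_le_mul_of_nonneg_left h hκ0.le

end ConditionNumber

/-! ### Online sensitivities -/

section Sensitivities

variable {n d : ℕ}

/-- The rows of `A`, extended by zero. -/
def rowSeq (A : Matrix (Fin n) (Fin d) ℝ) (i : ℕ) : Fin d → ℝ :=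
  if h : i < n then A ⟨i, h⟩ else 0

theorem rowSeq_of_lt (A : Matrix (Fin n) (Fin d) ℝ) {i : ℕ} (h : i < n) :
    rowSeq A i = A ⟨i, h⟩ := dif_pos h

theorem rowSeq_val (A : Matrix (Fin n) (Fin d) ℝ) (i : Fin n) : rowSeq A i = A i :=
  rowSeq_of_lt A i.2

/-- The `L₁` norm of `A x` restricted to the first `k` rows. -/
def prefixL1 (a : ℕ → Fin d → ℝ) (k : ℕ) (x : Fin d → ℝ) : ℝ :=
  ∑ j ∈ Finset.range k, |a j ⬝ᵥ x|

theorem prefixL1_nonneg (a : ℕ → Fin d → ℝ) (k : ℕ) (x : Fin d → ℝ) : 0 ≤ prefixL1 a k x :=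
  Finset.sum_nonneg fun _ _ => abs_nonneg _

theorem prefixL1_succ (a : ℕ → Fin d → ℝ) (k : ℕ) (x : Fin d → ℝ) :
    prefixL1 a (k + 1) x = prefixL1 a k x + |a k ⬝ᵥ x| := Finset.sum_range_succ _ _

theorem prefixL1_mono (a : ℕ → Fin d → ℝ) {k l : ℕ} (h : k ≤ l) (x : Fin d → ℝ) :
    prefixL1 a k x ≤ prefixL1 a l x :=
  Finset.sum_le_sum_of_subset_of_nonneg (Finset.range_mono h) fun _ _ _ => abs_nonneg _

theorem abs_dotProduct_le_prefixL1 (a : ℕ → Fin d → ℝ) {j k : ℕ} (h : j < k) (x : Fin d → ℝ) :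
    |a j ⬝ᵥ x| ≤ prefixL1 a k x :=
  Finset.single_le_sum (f := fun j => |a j ⬝ᵥ x|) (fun _ _ => abs_nonneg _)
    (Finset.mem_range.2 h)

theorem prefixL1_rowSeq (A : Matrix (Fin n) (Fin d) ℝ) (x : Fin d → ℝ) :
    prefixL1 (rowSeq A) n x = ∑ j, |A j ⬝ᵥ x| := by
  rw [prefixL1, Finset.sum_range]
  simp only [rowSeq_val]

theorem sqrt_dotProduct_self_le_sum_abs {ι : Type*} [Fintype ι] (y : ι → ℝ) :
    √(y ⬝ᵥ y) ≤ ∑ i, |y i| := by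
  refine Real.sqrt_le_iff.2 ⟨Finset.sum_nonneg fun _ _ => abs_nonneg _, ?_⟩
  rw [sq, Finset.sum_mul]
  refine Finset.sum_le_sum fun i hi => ?_
  rw [← abs_mul_abs_self]
  exact mul_le_mul_of_nonneg_left
    (Finset.single_le_sum (f := fun i => |y i|) (fun _ _ => abs_nonneg _) hi) (abs_nonneg _)

theorem exists_prefix_eq_and_sqrt_le (A : Matrix (Fin n) (Fin d) ℝ)
    (hA : ∀ i j, ∃ z : ℤ, A i j = z) {κ : ℝ} (hκ0 : 0 ≤ κ) (hκ : streamConditionNumber A ≤ κ) {i : ℕ}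
    (hi : i < n) (x : Fin d → ℝ) :
    ∃ y, (∀ j ≤ i, rowSeq A j ⬝ᵥ y = rowSeq A j ⬝ᵥ x) ∧
      √(y ⬝ᵥ y) ≤ κ * prefixL1 (rowSeq A) (i + 1) x := by
  have hn : 0 < n := by omega
  set B := consecutiveRows A ⟨0, hn⟩ ⟨i, hi⟩ with hB
  have hBκ : conditionNumber B ≤ κ := by
    refine le_trans ?_ hκ
    exact le_ciSup (f := fun ij : {p : Fin n × Fin n // p.1 ≤ p.2} =>
      conditionNumber (consecutiveRows A ij.1.1 ij.1.2)) (Set.finite_range _).bddAbove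
      ⟨(⟨0, hn⟩, ⟨i, hi⟩), Fin.mk_le_mk.2 (Nat.zero_le i)⟩
  obtain ⟨y, hy, hyx⟩ := exists_mulVec_eq_and_sqrt_le B (fun k j => hA _ _) hBκ x
  refine ⟨y, ?_, hyx.trans (mul_le_mul_of_nonneg_left ?_ hκ0)⟩
  · intro j hj
    have hjn : j < n := by omega
    rw [rowSeq_of_lt A hjn]
    exact congrFun hy ⟨⟨j, hjn⟩, Fin.mk_le_mk.2 (Nat.zero_le j), Fin.mk_le_mk.2 hj⟩
  · refine (sqrt_dotProduct_self_le_sum_abs _).trans (le_of_eq ?_)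
    rw [prefixL1]
    refine Finset.sum_bij (fun k _ => (k.1 : ℕ)) ?_ ?_ ?_ ?_
    · intro k _
      have : (k.1 : ℕ) ≤ i := k.2.2
      exact Finset.mem_range.2 (by omega)
    · intro k _ l _ h
      exact Subtype.ext (Fin.ext h)
    · intro j hj
      have hj' := Finset.mem_range.1 hj
      exact ⟨⟨⟨j, by omega⟩, Fin.mk_le_mk.2 (Nat.zero_le j), Fin.mk_le_mk.2 (by omega)⟩,
        Finset.mem_univ _, rfl⟩
    · intro k _
      rw [rowSeq_val]
      rfl

theorem abs_dotProduct_le_of_forall_abs_le {v x : Fin d → ℝ} {B : ℝ} (hB : 0 ≤ B)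
    (hv : ∀ j, |v j| ≤ B) : |v ⬝ᵥ x| ≤ B * d * √(x ⬝ᵥ x) := by
  have hx : ∀ j, |x j| ≤ √(x ⬝ᵥ x) := fun j => by
    apply Real.abs_le_sqrt
    rw [sq]
    exact Finset.single_le_sum (f := fun j => x j * x j) (fun _ _ => mul_self_nonneg _)
      (Finset.mem_univ j)
  calc |v ⬝ᵥ x| ≤ ∑ j, |v j * x j| := Finset.abs_sum_le_sum_abs _ _
    _ ≤ ∑ _j : Fin d, B * √(x ⬝ᵥ x) := by
      refine Finset.sum_le_sum fun j _ => ?_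
      rw [abs_mul]
      exact mul_le_mul (hv j) (hx j) (abs_nonneg _) hB
    _ = B * d * √(x ⬝ᵥ x) := by
      rw [Finset.sum_const, Finset.card_univ, Fintype.card_fin, nsmul_eq_mul]; ring

/-- With regularisation `κ⁻¹`, replacing `x` by a short vector with the same products with the
prefix makes the regularising term at most the prefix `L₁` norm; this is the factor 2. -/
theorem exists_online_sensitivities (b : ℕ) (hn : 2 ≤ n) (A : Matrix (Fin n) (Fin d) ℝ)
    (hA : ∀ i j, ∃ z : ℤ, A i j = (z : ℝ) ∧ |z| ≤ (n : ℤ) ^ b) {κ : ℝ} (hκ : 2 ≤ κ)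
    (hAκ : streamConditionNumber A ≤ κ) :
    ∃ w : ℕ → ℝ, (∀ i < n, 0 ≤ w i) ∧
      (∀ i < n, ∀ x, |rowSeq A i ⬝ᵥ x| ≤ 2 * w i * prefixL1 (rowSeq A) (i + 1) x) ∧
      ∑ i ∈ Finset.range n, w i ≤ 4 * (b + 4) * (d * Real.log n * Real.log κ) := by
  have hκ0 : 0 < κ := by linarith
  have hnR : (2 : ℝ) ≤ n := by exact_mod_cast hn
  have hn0 : (0 : ℝ) < n := by linarith
  have hl2 := Real.log_two_gt_d9
  have hln : 0.69 ≤ Real.log n := by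
    have := Real.log_le_log two_pos hnR; linarith
  have hlκ : 0.69 ≤ Real.log κ := by
    have := Real.log_le_log two_pos hκ; linarith
  obtain ⟨w, Q, hQ, hw, hQx, hdet⟩ :=
    exists_online_lewis_weights (rowSeq A) (inv_pos.2 hκ0) n
  refine ⟨w, fun i hi => (hw i hi).1, ?_, ?_⟩
  · intro i hi x
    obtain ⟨y, hy, hyx⟩ := exists_prefix_eq_and_sqrt_le A
      (fun i j => (hA i j).imp fun z hz => hz.1) hκ0.le hAκ hi x
    obtain ⟨hw0, -, hwx⟩ := hw i hi
    have h := hwx y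
    have hsum : ∑ j ∈ Finset.range (i + 1), |rowSeq A j ⬝ᵥ y| = prefixL1 (rowSeq A) (i + 1) x :=
      Finset.sum_congr rfl fun j hj => by
        rw [hy j (Nat.lt_succ_iff.1 (Finset.mem_range.1 hj))]
    rw [hsum, hy i le_rfl] at h
    have h2 : κ⁻¹ * √(y ⬝ᵥ y) ≤ prefixL1 (rowSeq A) (i + 1) x := by
      rwa [inv_mul_le_iff₀ hκ0]
    calc _ ≤ w i * (κ⁻¹ * √(y ⬝ᵥ y) + prefixL1 (rowSeq A) (i + 1) x) := h
      _ ≤ w i * (prefixL1 (rowSeq A) (i + 1) x + prefixL1 (rowSeq A) (i + 1) x) :=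
        mul_le_mul_of_nonneg_left (by linarith) hw0
      _ = _ := by ring
  · have hd0 : (0 : ℝ) ≤ d := Nat.cast_nonneg d
    have hb0 : (0 : ℝ) ≤ b := Nat.cast_nonneg b
    -- The determinant bound contains `log d`, which `log n` absorbs only when `d ≤ n`. Otherwise `w
    -- i ≤ 1` already gives a sum of at most `d`.
    rcases le_or_gt n d with hnd | hnd
    · have hnd' : (n : ℝ) ≤ d := by exact_mod_cast hnd
      calc ∑ i ∈ Finset.range n, w i ≤ ∑ i ∈ Finset.range n, (1 : ℝ) :=
            Finset.sum_le_sum fun i hi => (hw i (Finset.mem_range.1 hi)).2.1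
        _ = n := by simp
        _ ≤ d := hnd'
        _ ≤ 4 * (0 + 4) * (d * 0.69 * 0.69) := by nlinarith
        _ ≤ _ := by gcongr
    · have hnd' : (d : ℝ) ≤ n := by exact_mod_cast hnd.le
      set L : ℝ := n * (n ^ b * d) with hL
      have hL0 : 0 ≤ L := by positivity
      have hQ' : ∀ x, √(x ⬝ᵥ Q *ᵥ x) ≤ (κ⁻¹ + L) * √(x ⬝ᵥ x) := by
        intro x
        refine (hQx x).trans ?_
        rw [add_mul, add_le_add_iff_left]
        calc ∑ j ∈ Finset.range n, |rowSeq A j ⬝ᵥ x|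
            ≤ ∑ j ∈ Finset.range n, (n : ℝ) ^ b * d * √(x ⬝ᵥ x) := by
              refine Finset.sum_le_sum fun j hj => ?_
              rw [rowSeq_of_lt A (Finset.mem_range.1 hj)]
              refine abs_dotProduct_le_of_forall_abs_le (by positivity) fun k => ?_
              obtain ⟨z, hz, hzb⟩ := hA ⟨j, Finset.mem_range.1 hj⟩ k
              rw [hz]
              exact_mod_cast hzb
          _ = L * √(x ⬝ᵥ x) := by simp [hL]; ring
      have h := sum_le_of_exp_mul_le_det hQ (inv_pos.2 hκ0) hL0 hQ' hdet
      have hlog : Real.log ((κ⁻¹ + L) / κ⁻¹) ≤ Real.log κ + (b + 3) * Real.log n := by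
        have h1 : (κ⁻¹ + L) / κ⁻¹ ≤ κ * (n : ℝ) ^ (b + 3) := by
          have hL1 : L ≤ (n : ℝ) ^ (b + 2) := by
            rw [hL, pow_add, sq]
            have : (0 : ℝ) ≤ n ^ b := by positivity
            calc (n : ℝ) * (n ^ b * d) ≤ n * (n ^ b * n) := by gcongr
              _ = _ := by ring
          have hp1 : (1 : ℝ) ≤ (n : ℝ) ^ (b + 2) := one_le_pow₀ (by linarith)
          have h2 : (κ⁻¹ + L) / κ⁻¹ = 1 + κ * L := by field_simp
          have h4 : κ * L ≤ κ * (n : ℝ) ^ (b + 2) := mul_le_mul_of_nonneg_left hL1 hκ0.le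
          have h5 : 1 ≤ κ * (n : ℝ) ^ (b + 2) := by nlinarith
          have h6 := mul_le_mul_of_nonneg_left hnR (by positivity : 0 ≤ κ * (n : ℝ) ^ (b + 2))
          rw [h2, pow_succ]
          linarith
        have h3 := Real.log_le_log (by positivity) h1
        rwa [Real.log_mul hκ0.ne' (by positivity), Real.log_pow, Nat.cast_add, Nat.cast_ofNat] at h3
      have hprod : Real.log κ + (b + 3) * Real.log n ≤
          2 * (b + 4) * (Real.log n * Real.log κ) := by
        have h1 : Real.log κ ≤ 2 * (Real.log n * Real.log κ) := by nlinarith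
        have h2 : Real.log n ≤ 2 * (Real.log n * Real.log κ) := by nlinarith
        nlinarith
      calc _ ≤ 2 * d * (2 * (b + 4) * (Real.log n * Real.log κ)) :=
            h.trans (mul_le_mul_of_nonneg_left (hlog.trans hprod) (by positivity))
        _ = _ := by ring

end Sensitivities

/-! ### The law of the sample and a stopped supermartingale bound -/

section Law

variable {d : ℕ}

/-- The law of the sample after processing the rows `a i, …, a (i + m - 1)`, started with `M`. -/
def lawFrom (α Δ : ℝ) (a : ℕ → Fin d → ℝ) : ℕ → ℕ → Sample d → PMF (Sample d)
  | _, 0, M => PMF.pure M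
  | i, m + 1, M => (step α Δ M (a i)).bind (lawFrom α Δ a (i + 1) m)

theorem foldl_step_eq_bind_lawFrom (α Δ : ℝ) (a : ℕ → Fin d → ℝ) (m : ℕ) :
    ∀ (i : ℕ) (μ : PMF (Sample d)),
      ((List.range' i m).map a).foldl (fun μ r => μ.bind fun M => step α Δ M r) μ =
        μ.bind (lawFrom α Δ a i m) := by
  induction m with
  | zero => intro i μ; exact (PMF.bind_pure μ).symm
  | succ m ih =>
    intro i μ
    rw [List.range'_succ, List.map_cons, List.foldl_cons, ih, PMF.bind_bind]
    rfl

theorem sampleLaw_eq_lawFrom {n : ℕ} (α Δ : ℝ) (A : Matrix (Fin n) (Fin d) ℝ) :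
    sampleLaw α Δ A = lawFrom α Δ (rowSeq A) 0 n [] := by
  have h : List.ofFn A.row = (List.range' 0 n).map (rowSeq A) := by
    rw [← List.range_eq_range']
    apply List.ext_getElem (by simp)
    intro i h1 h2
    have hi : i < n := by simpa using h1
    rw [List.getElem_ofFn, List.getElem_map, List.getElem_range, rowSeq_of_lt A hi]
    rfl
  rw [sampleLaw, h, foldl_step_eq_bind_lawFrom, PMF.pure_bind]

theorem toOuterMeasure_step_bind (α Δ : ℝ) (M : Sample d) (a : Fin d → ℝ)
    (f : Sample d → PMF (Sample d)) (s : Set (Sample d)) :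
    ((step α Δ M a).bind f).toOuterMeasure s =
      (samplingProb α Δ M a : ℝ≥0∞) *
        (f (M ++ [⟨a, (samplingProb α Δ M a : ℝ)⟩])).toOuterMeasure s +
      ((1 - samplingProb α Δ M a : ℝ≥0) : ℝ≥0∞) * (f M).toOuterMeasure s := by
  rw [step, PMF.bind_map, PMF.toOuterMeasure_bind_apply, tsum_fintype, Fintype.sum_bool]
  simp [coin]

/-- A stopped supermartingale without stopping times: the recursion goes backwards over the
remaining rows, and where `W ≥ 1` a probability is trivially at most `W`. So invariant and decrease
are required only while `W < 1`. Outcomes of probability zero need not preserve the invariant. -/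
theorem toOuterMeasure_lawFrom_le {α Δ : ℝ} {a : ℕ → Fin d → ℝ} {n : ℕ}
    {I : ℕ → Sample d → Prop} {W : ℕ → Sample d → ℝ} {s : Set (Sample d)}
    (hW : ∀ i M, 0 ≤ W i M)
    (hstep : ∀ i < n, ∀ M, I i M → W i M < 1 → ∀ p : ℝ, p = samplingProb α Δ M (a i) →
      (0 < p → I (i + 1) (M ++ [⟨a i, p⟩])) ∧ (p < 1 → I (i + 1) M) ∧
        p * W (i + 1) (M ++ [⟨a i, p⟩]) + (1 - p) * W (i + 1) M ≤ W i M)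
    (hs : ∀ M ∈ s, I n M → 1 ≤ W n M) (m : ℕ) :
    ∀ (i : ℕ) (M : Sample d), i + m = n → I i M →
      (lawFrom α Δ a i m M).toOuterMeasure s ≤ ENNReal.ofReal (W i M) := by
  induction m with
  | zero =>
    intro i M hi hIM
    rw [add_zero] at hi
    subst hi
    rw [lawFrom, PMF.toOuterMeasure_pure_apply]
    split_ifs with hM
    · rw [← ENNReal.ofReal_one]
      exact ENNReal.ofReal_le_ofReal (hs M hM hIM)
    · exact zero_le
  | succ m ih =>
    intro i M hi hIM
    by_cases hWM : 1 ≤ W i M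
    · calc _ ≤ (lawFrom α Δ a i (m + 1) M).toOuterMeasure Set.univ :=
            MeasureTheory.measure_mono (Set.subset_univ _)
        _ = 1 := (PMF.toOuterMeasure_apply_eq_one_iff _ _).2 (Set.subset_univ _)
        _ ≤ _ := by
          rw [← ENNReal.ofReal_one]
          exact ENNReal.ofReal_le_ofReal hWM
    · rw [lawFrom, toOuterMeasure_step_bind]
      obtain ⟨h1, h2, h3⟩ := hstep i (by omega) M hIM (not_le.1 hWM) _ rfl
      have hp1 : samplingProb α Δ M (a i) ≤ 1 := min_le_left _ _
      set p := samplingProb α Δ M (a i) with hp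
      refine le_trans ?_ (ENNReal.ofReal_le_ofReal h3)
      have hp1' : (p : ℝ) ≤ 1 := by exact_mod_cast hp1
      have hq0 : 0 ≤ 1 - (p : ℝ) := by linarith
      rw [ENNReal.ofReal_add (mul_nonneg p.coe_nonneg (hW _ _)) (mul_nonneg hq0 (hW _ _)),
        ENNReal.ofReal_mul p.coe_nonneg, ENNReal.ofReal_mul hq0,
        ENNReal.ofReal_coe_nnreal]
      have hq : ENNReal.ofReal (1 - (p : ℝ)) = ((1 - p : ℝ≥0) : ℝ≥0∞) := by
        rw [← NNReal.coe_one, ← NNReal.coe_sub hp1, ENNReal.ofReal_coe_nnreal]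
      rw [hq]
      refine add_le_add ?_ ?_
      · rcases eq_or_ne p 0 with h0 | h0
        · simp [h0]
        · exact mul_le_mul_right (ih (i + 1) _ (by omega)
            (h1 (NNReal.coe_pos.2 (pos_iff_ne_zero.2 h0)))) _
      · rcases hp1.eq_or_lt with h0 | h0
        · simp [h0]
        · exact mul_le_mul_right (ih (i + 1) _ (by omega) (h2 (by exact_mod_cast h0))) _

theorem ofReal_one_sub_le_toOuterMeasure {Ω : Type*} (μ : PMF Ω) {s t : Set Ω} {r : ℝ} (hr : 0 ≤ r)
    (ht : μ.toOuterMeasure t ≤ ENNReal.ofReal r) (hst : ∀ x, x ∉ t → x ∈ s) :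
    ENNReal.ofReal (1 - r) ≤ μ.toOuterMeasure s := by
  rw [ENNReal.ofReal_sub _ hr, ENNReal.ofReal_one, tsub_le_iff_right]
  calc (1 : ℝ≥0∞) = μ.toOuterMeasure Set.univ :=
        ((PMF.toOuterMeasure_apply_eq_one_iff _ _).2 (Set.subset_univ _)).symm
    _ ≤ μ.toOuterMeasure (s ∪ t) := MeasureTheory.measure_mono fun x _ => by
        by_cases h : x ∈ t
        · exact Or.inr h
        · exact Or.inl (hst x h)
    _ ≤ μ.toOuterMeasure s + μ.toOuterMeasure t := MeasureTheory.measure_union_le _ _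
    _ ≤ _ := by gcongr

/-- The centred increment has mean zero and variance `y² / p - y² ≤ R y`; both its values are at
most `R` in size, so `exp u ≤ 1 + u + u²` applies. If `p = 1` there is no deviation. -/
theorem mul_exp_add_mul_exp_le {p y R t : ℝ} (hp0 : 0 ≤ p) (hp1 : p ≤ 1) (hy : 0 ≤ y)
    (hR : 0 ≤ R) (h : p = 1 ∨ y ≤ p * R) (ht : |t| * R ≤ 1) :
    p * Real.exp (t * (p⁻¹ * y - y)) + (1 - p) * Real.exp (-(t * y)) ≤
      Real.exp (t ^ 2 * R * y) := by
  rcases h with rfl | h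
  · simp only [inv_one, one_mul, sub_self, mul_zero, Real.exp_zero, zero_mul, add_zero]
    exact Real.one_le_exp (by positivity)
  rcases hp0.eq_or_lt with rfl | hp
  · have : y = 0 := le_antisymm (by simpa using h) hy
    simp [this]
  have hquad : ∀ u : ℝ, |u| ≤ 1 → Real.exp u ≤ 1 + u + u ^ 2 := by
    intro u hu
    have := (abs_le.1 (Real.abs_exp_sub_one_sub_id_le hu)).2
    linarith
  have hyR : p⁻¹ * y ≤ R := by rwa [inv_mul_le_iff₀ hp]
  have hpy : y ≤ p⁻¹ * y := le_mul_of_one_le_left hy ((one_le_inv₀ hp).2 hp1)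
  have h1 := hquad (t * (p⁻¹ * y - y)) (by
    rw [abs_mul, abs_of_nonneg (by linarith : 0 ≤ p⁻¹ * y - y)]
    exact (mul_le_mul_of_nonneg_left (by linarith) (abs_nonneg t)).trans ht)
  have h2 := hquad (-(t * y)) (by
    rw [abs_neg, abs_mul, abs_of_nonneg hy]
    exact (mul_le_mul_of_nonneg_left (by linarith) (abs_nonneg t)).trans ht)
  calc _ ≤ p * (1 + t * (p⁻¹ * y - y) + (t * (p⁻¹ * y - y)) ^ 2) +
        (1 - p) * (1 + -(t * y) + (-(t * y)) ^ 2) :=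
        add_le_add (mul_le_mul_of_nonneg_left h1 hp0)
          (mul_le_mul_of_nonneg_left h2 (by linarith))
    _ = 1 + t ^ 2 * ((p⁻¹ * y) * y - y ^ 2) := by field_simp; ring
    _ ≤ 1 + t ^ 2 * (R * y) := by
      have : (p⁻¹ * y) * y ≤ R * y := mul_le_mul_of_nonneg_right hyR hy
      have h3 : 0 ≤ y ^ 2 := by positivity
      have := mul_le_mul_of_nonneg_left (show (p⁻¹ * y) * y - y ^ 2 ≤ R * y by linarith)
        (sq_nonneg t)
      linarith
    _ ≤ _ := by
      have := Real.add_one_le_exp (t ^ 2 * R * y)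
      linarith

end Law

/-! ### Sampling probabilities -/

section SamplingProb

variable {d : ℕ}

/-- Orthogonal projection. It extends the algorithm's maximum over the row span to all test vectors.
-/
theorem exists_mem_forall_dotProduct_eq (S : Submodule ℝ (Fin d → ℝ)) (x : Fin d → ℝ) :
    ∃ u ∈ S, ∀ y ∈ S, y ⬝ᵥ x = y ⬝ᵥ u := by
  set e := (WithLp.linearEquiv 2 ℝ (Fin d → ℝ)).symm with he
  obtain ⟨u, hu, v, hv, huv⟩ := Submodule.exists_add_mem_mem_orthogonal
    (K := S.map (e : (Fin d → ℝ) →ₗ[ℝ] EuclideanSpace ℝ (Fin d))) (WithLp.toLp 2 x)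
  obtain ⟨u', hu', rfl⟩ := Submodule.mem_map.1 hu
  refine ⟨u', hu', fun y hy => ?_⟩
  have h0 : inner ℝ (WithLp.toLp 2 y) v = 0 := hv _ (Submodule.mem_map_of_mem hy)
  have h1 : inner ℝ (WithLp.toLp 2 y) (WithLp.toLp 2 x) =
      inner ℝ (WithLp.toLp 2 y) (WithLp.toLp 2 u') := by
    rw [huv, inner_add_right, h0, add_zero]
    rfl
  rw [EuclideanSpace.inner_toLp_toLp, EuclideanSpace.inner_toLp_toLp] at h1
  simpa [dotProduct_comm] using h1

theorem exists_dotProduct_ne_zero_of_notMem {S : Submodule ℝ (Fin d → ℝ)} {a : Fin d → ℝ}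
    (ha : a ∉ S) : ∃ x, a ⬝ᵥ x ≠ 0 ∧ ∀ y ∈ S, y ⬝ᵥ x = 0 := by
  obtain ⟨u, hu, hau⟩ := exists_mem_forall_dotProduct_eq S a
  have hperp : ∀ y ∈ S, y ⬝ᵥ (a - u) = 0 := fun y hy => by
    rw [dotProduct_sub, hau y hy, sub_self]
  refine ⟨a - u, fun h => ha ?_, hperp⟩
  have h1 : (a - u) ⬝ᵥ (a - u) = 0 := by
    rw [sub_dotProduct, h, hperp u hu, sub_self]
  rw [dotProduct_self_eq_zero, sub_eq_zero] at h1
  rwa [h1]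

theorem Sample.l1Norm_nonneg (M : Sample d) (x : Fin d → ℝ) : 0 ≤ M.l1Norm x :=
  List.sum_nonneg fun y hy => by
    obtain ⟨s, -, rfl⟩ := List.mem_map.1 hy
    exact abs_nonneg _

theorem Sample.l1Norm_congr (M : Sample d) {x y : Fin d → ℝ}
    (h : ∀ v ∈ M.rowSpan, v ⬝ᵥ x = v ⬝ᵥ y) : M.l1Norm x = M.l1Norm y := by
  rw [l1Norm, l1Norm]
  congr 1
  refine List.map_congr_left fun s hs => ?_
  rw [h _ (Submodule.subset_span ⟨s, hs, rfl⟩)]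

/-- The `L₁` sensitivity of `a` with respect to the sample `M`. -/
def Sample.sensitivity (M : Sample d) (a : Fin d → ℝ) : ℝ :=
  ⨆ x : M.rowSpan, |a ⬝ᵥ (x : Fin d → ℝ)| / (M.l1Norm x + |a ⬝ᵥ (x : Fin d → ℝ)|)

theorem Sample.sensitivity_nonneg (M : Sample d) (a : Fin d → ℝ) : 0 ≤ M.sensitivity a :=
  Real.iSup_nonneg fun _ => div_nonneg (abs_nonneg _)
    (add_nonneg (M.l1Norm_nonneg _) (abs_nonneg _))

theorem Sample.abs_dotProduct_le_sensitivity_mul (M : Sample d) {a : Fin d → ℝ}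
    (ha : a ∈ M.rowSpan) (x : Fin d → ℝ) :
    |a ⬝ᵥ x| ≤ M.sensitivity a * (M.l1Norm x + |a ⬝ᵥ x|) := by
  obtain ⟨u, hu, hxu⟩ := exists_mem_forall_dotProduct_eq M.rowSpan x
  rw [hxu a ha, M.l1Norm_congr hxu]
  have hM := M.l1Norm_nonneg u
  have hbdd : BddAbove (Set.range fun x : M.rowSpan =>
      |a ⬝ᵥ (x : Fin d → ℝ)| / (M.l1Norm x + |a ⬝ᵥ (x : Fin d → ℝ)|)) := ⟨1, by
    rintro _ ⟨y, rfl⟩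
    have := M.l1Norm_nonneg y
    exact div_le_one_of_le₀ (by linarith) (by positivity)⟩
  have h := le_ciSup hbdd ⟨u, hu⟩
  change |a ⬝ᵥ u| / (M.l1Norm u + |a ⬝ᵥ u|) ≤ M.sensitivity a at h
  rcases (abs_nonneg (a ⬝ᵥ u)).eq_or_lt with h0 | h0
  · rw [← h0]
    exact mul_nonneg (M.sensitivity_nonneg a) (by linarith)
  · rwa [div_le_iff₀ (by linarith)] at h

theorem samplingProb_le_one (α Δ : ℝ) (M : Sample d) (a : Fin d → ℝ) :
    (samplingProb α Δ M a : ℝ) ≤ 1 := by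
  exact_mod_cast (min_le_left _ _ : samplingProb α Δ M a ≤ 1)

theorem samplingProb_zero (α Δ : ℝ) (M : Sample d) : samplingProb α Δ M 0 = 0 := by
  have : importance Δ M 0 = 0 := by
    rw [importance, if_pos (Submodule.zero_mem _)]
    simp
  rw [samplingProb, this]
  simp

theorem samplingProb_eq_one_of_notMem {α : ℝ} (hα : 1 ≤ α) (Δ : ℝ) {M : Sample d} {a : Fin d → ℝ}
    (ha : a ∉ M.rowSpan) : samplingProb α Δ M a = 1 := by
  rw [samplingProb, importance, if_neg ha, mul_one, min_eq_left]
  exact Real.one_le_toNNReal.2 hα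

theorem samplingProb_of_mem {α Δ : ℝ} (hα : 0 ≤ α) (hΔ : 0 ≤ Δ) {M : Sample d} {a : Fin d → ℝ}
    (ha : a ∈ M.rowSpan) :
    (samplingProb α Δ M a : ℝ) = min 1 (α * (2 * Δ * M.sensitivity a)) := by
  have h := M.sensitivity_nonneg a
  rw [samplingProb, importance, if_pos ha, NNReal.coe_min, NNReal.coe_one,
    Real.coe_toNNReal _ (by rw [← Sample.sensitivity]; positivity)]
  rfl

/-- The factor 2 in the importance absorbs the factor-2 error of the sample. A row outside the span
is kept for certain. -/
theorem samplingProb_eq_one_or_abs_dotProduct_le {α Δ : ℝ} (hα : 1 ≤ α) (hΔ : 0 ≤ Δ)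
    {M : Sample d} {P : (Fin d → ℝ) → ℝ} (hP : ∀ x, M.l1Norm x ≤ 2 * P x) (a : Fin d → ℝ) :
    (samplingProb α Δ M a : ℝ) = 1 ∨
      ∀ x, α * Δ * |a ⬝ᵥ x| ≤ samplingProb α Δ M a * (P x + |a ⬝ᵥ x|) := by
  by_cases ha : a ∈ M.rowSpan
  · rw [samplingProb_of_mem (by linarith) hΔ ha]
    rcases le_total 1 (α * (2 * Δ * M.sensitivity a)) with h | h
    · exact Or.inl (min_eq_left h)
    · refine Or.inr fun x => ?_
      rw [min_eq_right h]
      have h1 := M.abs_dotProduct_le_sensitivity_mul ha x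
      have h2 := hP x
      have h3 := M.sensitivity_nonneg a
      have hαΔ : 0 ≤ α * Δ := mul_nonneg (by linarith) hΔ
      calc α * Δ * |a ⬝ᵥ x| ≤ α * Δ * (M.sensitivity a * (2 * (P x + |a ⬝ᵥ x|))) := by
            refine mul_le_mul_of_nonneg_left (h1.trans ?_) hαΔ
            refine mul_le_mul_of_nonneg_left ?_ h3
            have := abs_nonneg (a ⬝ᵥ x)
            linarith
        _ = _ := by ring
  · left
    rw [samplingProb_eq_one_of_notMem hα Δ ha, NNReal.coe_one]

/-- For a row outside the span, a vector orthogonal to the sample but not to the row has `P x = 0`,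
which forces `w ≥ 1 / 2`; probability 1 is then affordable. -/
theorem samplingProb_le {α Δ : ℝ} (hα : 1 ≤ α) (hΔ : 1 ≤ Δ) {M : Sample d}
    {P : (Fin d → ℝ) → ℝ} (hP : ∀ x, P x ≤ 2 * M.l1Norm x) {a : Fin d → ℝ} {w : ℝ} (hw : 0 ≤ w)
    (ha : ∀ x, |a ⬝ᵥ x| ≤ 2 * w * (P x + |a ⬝ᵥ x|)) :
    (samplingProb α Δ M a : ℝ) ≤ 8 * α * Δ * w := by
  by_cases haM : a ∈ M.rowSpan
  · rw [samplingProb_of_mem (by linarith) (by linarith) haM]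
    have hS : M.sensitivity a ≤ 4 * w := by
      refine Real.iSup_le (fun x => ?_) (by positivity)
      have hM := M.l1Norm_nonneg x
      have habs := abs_nonneg (a ⬝ᵥ (x : Fin d → ℝ))
      refine div_le_of_le_mul₀ (by linarith) (by positivity) ((ha x).trans ?_)
      have := mul_le_mul_of_nonneg_left
        (show P x + |a ⬝ᵥ (x : Fin d → ℝ)| ≤ 2 * (M.l1Norm x + |a ⬝ᵥ (x : Fin d → ℝ)|) by
          have := hP x; linarith) (show 0 ≤ 2 * w by positivity)
      linarith
    refine (min_le_right _ _).trans ?_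
    have hαΔ : 0 ≤ α * Δ := by positivity
    nlinarith
  · obtain ⟨x, hax, hx⟩ := exists_dotProduct_ne_zero_of_notMem haM
    have hM : M.l1Norm x = 0 := by
      have h0 : M.l1Norm x = M.l1Norm 0 :=
        M.l1Norm_congr fun v hv => by rw [hx v hv, dotProduct_zero]
      rw [h0, Sample.l1Norm]
      simp
    have hpos := abs_pos.2 hax
    have h1 := ha x
    have h2 := hP x
    rw [hM, mul_zero] at h2
    have h3 : 1 ≤ 2 * w := by
      have h4 : 2 * w * (P x + |a ⬝ᵥ x|) ≤ 2 * w * |a ⬝ᵥ x| :=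
        mul_le_mul_of_nonneg_left (by linarith) (by positivity)
      have h5 : 1 * |a ⬝ᵥ x| ≤ 2 * w * |a ⬝ᵥ x| := by linarith
      exact le_of_mul_le_mul_right h5 hpos
    have h6 : 1 ≤ α * Δ := one_le_mul_of_one_le_of_one_le hα hΔ
    refine (samplingProb_le_one _ _ _ _).trans ?_
    nlinarith

end SamplingProb

/-! ### Exponential potentials -/

section Potentials

variable {d : ℕ}

/-- The importance-weighted sum of `f` over the sampled rows. -/
def Sample.weightedSum (f : (Fin d → ℝ) → ℝ) (M : Sample d) : ℝ :=
  (M.map fun s => s.prob⁻¹ * f s.row).sum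

theorem Sample.weightedSum_append (f : (Fin d → ℝ) → ℝ) (M : Sample d) (r : SampledRow d) :
    Sample.weightedSum f (M ++ [r]) = M.weightedSum f + r.prob⁻¹ * f r.row := by
  simp [weightedSum]

/-- The two-sided exponential potential at time `i` of the deviation at time `k` of the weighted
sum of `f` from its mean. -/
def deviationPotential (a : ℕ → Fin d → ℝ) (R t η : ℝ) (k : ℕ) (f : (Fin d → ℝ) → ℝ) (i : ℕ)
    (M : Sample d) : ℝ :=
  if i ≤ k then
    Real.exp (t ^ 2 * R * (1 - ∑ j ∈ Finset.range i, f (a j)) - t * η) *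
      (Real.exp (t * (M.weightedSum f - ∑ j ∈ Finset.range i, f (a j))) +
        Real.exp (-t * (M.weightedSum f - ∑ j ∈ Finset.range i, f (a j))))
  else 0

theorem deviationPotential_nonneg (a : ℕ → Fin d → ℝ) (R t η : ℝ) (k : ℕ)
    (f : (Fin d → ℝ) → ℝ) (i : ℕ) (M : Sample d) : 0 ≤ deviationPotential a R t η k f i M := by
  rw [deviationPotential]
  split_ifs <;> positivity

theorem deviationPotential_step {a : ℕ → Fin d → ℝ} {R t η : ℝ} {k : ℕ} {f : (Fin d → ℝ) → ℝ}
    {i : ℕ} {p : ℝ} (M : Sample d) (hp0 : 0 ≤ p) (hp1 : p ≤ 1) (hR : 0 ≤ R) (ht : 0 ≤ t)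
    (htR : t * R ≤ 1) (hf : 0 ≤ f (a i)) (h : i < k → p = 1 ∨ f (a i) ≤ p * R) :
    p * deviationPotential a R t η k f (i + 1) (M ++ [⟨a i, p⟩]) +
      (1 - p) * deviationPotential a R t η k f (i + 1) M ≤ deviationPotential a R t η k f i M := by
  -- After time `k` the potential is zero: the deviation is needed only for the decision at time
  -- `k`, and `f` need not be controlled by `p` from then on.
  by_cases hik : i + 1 ≤ k
  swap
  · rw [deviationPotential, deviationPotential, if_neg hik, if_neg hik]
    simpa using deviationPotential_nonneg a R t η k f i M
  rw [deviationPotential, deviationPotential, deviationPotential, if_pos hik, if_pos hik,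
    if_pos (by omega), Sample.weightedSum_append, Finset.sum_range_succ]
  set y := f (a i) with hy
  set X := M.weightedSum f - ∑ j ∈ Finset.range i, f (a j) with hX
  set H := ∑ j ∈ Finset.range i, f (a j) with hH
  have key : ∀ u : ℝ, |u| = t →
      p * Real.exp (u * (p⁻¹ * y - y)) + (1 - p) * Real.exp (-(u * y)) ≤
        Real.exp (t ^ 2 * R * y) := by
    intro u hu
    have := mul_exp_add_mul_exp_le (t := u) hp0 hp1 hf hR (h (by omega)) (by rw [hu]; exact htR)
    rwa [← sq_abs, hu] at this
  have h1 := key t (abs_of_nonneg ht)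
  have h2 := key (-t) (by rw [abs_neg, abs_of_nonneg ht])
  have hc : Real.exp (t ^ 2 * R * (1 - H) - t * η) =
      Real.exp (t ^ 2 * R * (1 - (H + y)) - t * η) * Real.exp (t ^ 2 * R * y) := by
    rw [← Real.exp_add]; congr 1; ring
  have e1 : ∀ u : ℝ, Real.exp (u * (M.weightedSum f + p⁻¹ * y - (H + y))) =
      Real.exp (u * X) * Real.exp (u * (p⁻¹ * y - y)) := by
    intro u
    rw [← Real.exp_add]; congr 1; rw [hX]; ring
  have e2 : ∀ u : ℝ, Real.exp (u * (M.weightedSum f - (H + y))) =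
      Real.exp (u * X) * Real.exp (-(u * y)) := by
    intro u
    rw [← Real.exp_add]; congr 1; rw [hX]; ring
  rw [hc, e1, e1, e2, e2, mul_assoc (Real.exp (t ^ 2 * R * (1 - (H + y)) - t * η))]
  have g1 := mul_le_mul_of_nonneg_left h1 (Real.exp_nonneg (t * X))
  have g2 := mul_le_mul_of_nonneg_left h2 (Real.exp_nonneg (-t * X))
  have g := mul_le_mul_of_nonneg_left (add_le_add g1 g2)
    (Real.exp_nonneg (t ^ 2 * R * (1 - (H + y)) - t * η))
  linarith

theorem abs_weightedSum_sub_one_le {a : ℕ → Fin d → ℝ} {R t η : ℝ} {k : ℕ}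
    {f : (Fin d → ℝ) → ℝ} {M : Sample d} (ht : 0 < t)
    (hf : ∑ j ∈ Finset.range k, f (a j) = 1) (h : deviationPotential a R t η k f k M < 1) :
    |M.weightedSum f - 1| ≤ η := by
  rw [deviationPotential, if_pos le_rfl, hf, sub_self, mul_zero, zero_sub, mul_add,
    ← Real.exp_add, ← Real.exp_add] at h
  have h1 : Real.exp (-(t * η) + t * (M.weightedSum f - 1)) < 1 :=
    lt_of_le_of_lt (le_add_of_nonneg_right (Real.exp_nonneg _)) h
  have h2 : Real.exp (-(t * η) + -t * (M.weightedSum f - 1)) < 1 :=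
    lt_of_le_of_lt (le_add_of_nonneg_left (Real.exp_nonneg _)) h
  rw [Real.exp_lt_one_iff] at h1 h2
  rw [abs_le]
  constructor <;> nlinarith

theorem deviationPotential_zero_nil (a : ℕ → Fin d → ℝ) {R η : ℝ} (hR : 0 < R) (k : ℕ)
    (f : (Fin d → ℝ) → ℝ) :
    deviationPotential a R (η / (2 * R)) η k f 0 [] = 2 * Real.exp (-(η ^ 2 / (4 * R))) := by
  rw [deviationPotential, if_pos (Nat.zero_le k)]
  simp only [Sample.weightedSum, List.map_nil, List.sum_nil, Finset.range_zero, Finset.sum_empty,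
    sub_zero, mul_zero, Real.exp_zero, mul_one]
  rw [show (η / (2 * R)) ^ 2 * R - η / (2 * R) * η = -(η ^ 2 / (4 * R)) by field_simp; ring]
  ring

/-- The exponential potential of the number of sampled rows. -/
def lengthPotential (q : ℕ → ℝ) (n : ℕ) (T : ℝ) (i : ℕ) (M : Sample d) : ℝ :=
  Real.exp (M.length + 2 * (∑ j ∈ Finset.range n, q j - ∑ j ∈ Finset.range i, q j) - T)

theorem lengthPotential_step {q : ℕ → ℝ} {n : ℕ} {T : ℝ} {i : ℕ} {p : ℝ} (M : Sample d)
    (a : Fin d → ℝ) (hp0 : 0 ≤ p) (hpq : p ≤ q i) :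
    p * lengthPotential q n T (i + 1) (M ++ [⟨a, p⟩]) + (1 - p) * lengthPotential q n T (i + 1) M ≤
      lengthPotential q n T i M := by
  rw [lengthPotential, lengthPotential, lengthPotential, List.length_append, List.length_singleton,
    Finset.sum_range_succ]
  set H := ∑ j ∈ Finset.range n, q j
  set h := ∑ j ∈ Finset.range i, q j
  set E := Real.exp (M.length + 2 * (H - (h + q i)) - T) with hE
  have e1 : Real.exp (((M.length + 1 : ℕ) : ℝ) + 2 * (H - (h + q i)) - T) = E * Real.exp 1 := by
    rw [hE, ← Real.exp_add]; congr 1; push_cast; ring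
  have e2 : Real.exp (M.length + 2 * (H - h) - T) = E * Real.exp (2 * q i) := by
    rw [hE, ← Real.exp_add]; congr 1; ring
  rw [e1, e2]
  -- Because `e - 1 ≤ 2`.
  have h3 : p * Real.exp 1 + (1 - p) ≤ Real.exp (2 * q i) := by
    have he := Real.exp_one_lt_d9
    have h4 := Real.add_one_le_exp (2 * q i)
    nlinarith
  have hE0 : 0 ≤ E := Real.exp_nonneg _
  have := mul_le_mul_of_nonneg_left h3 hE0
  linarith

theorem mul_sum_add_mul_sum_le {ι : Type*} {s : Finset ι} {p q : ℝ} {u v w : ι → ℝ}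
    (h : ∀ j ∈ s, p * u j + q * v j ≤ w j) :
    p * ∑ j ∈ s, u j + q * ∑ j ∈ s, v j ≤ ∑ j ∈ s, w j := by
  rw [Finset.mul_sum, Finset.mul_sum, ← Finset.sum_add_distrib]
  exact Finset.sum_le_sum h

end Potentials

/-! ### The combined potential and its failure bound -/

section Concentration

variable {d : ℕ}

/-- The `L₁` norm of the first `k` rows as a seminorm. -/
def prefixL1Seminorm (a : ℕ → Fin d → ℝ) (k : ℕ) : Seminorm ℝ (Fin d → ℝ) :=
  Seminorm.of (prefixL1 a k)
    (fun x y => by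
      rw [prefixL1, prefixL1, prefixL1, ← Finset.sum_add_distrib]
      refine Finset.sum_le_sum fun j _ => ?_
      rw [dotProduct_add]
      exact abs_add_le _ _)
    (fun t x => by
      rw [prefixL1, prefixL1, Finset.mul_sum]
      refine Finset.sum_congr rfl fun j _ => ?_
      rw [dotProduct_smul, smul_eq_mul, abs_mul, Real.norm_eq_abs])

/-- The `L₁` norm of the sample as a seminorm. -/
def Sample.l1Seminorm (M : Sample d) : Seminorm ℝ (Fin d → ℝ) :=
  Seminorm.of M.l1Norm
    (fun x y => by
      rw [l1Norm, l1Norm, l1Norm, ← List.sum_map_add]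
      refine List.sum_le_sum fun s _ => ?_
      rw [dotProduct_add]
      exact abs_add_le _ _)
    (fun t x => by
      rw [l1Norm, l1Norm, ← List.sum_map_mul_left]
      congr 1
      refine List.map_congr_left fun s _ => ?_
      rw [dotProduct_smul, smul_eq_mul, abs_mul, Real.norm_eq_abs])

theorem Sample.l1Seminorm_apply (M : Sample d) (x : Fin d → ℝ) : M.l1Seminorm x = M.l1Norm x := rfl

/-- Every sampled row is one of the first `i` rows, sampled with positive probability. -/
def Sample.IsDrawnFrom (a : ℕ → Fin d → ℝ) (i : ℕ) (M : Sample d) : Prop :=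
  ∀ s ∈ M, 0 < s.prob ∧ ∃ j < i, s.row = a j

theorem Sample.IsDrawnFrom.succ {a : ℕ → Fin d → ℝ} {i : ℕ} {M : Sample d}
    (h : M.IsDrawnFrom a i) : M.IsDrawnFrom a (i + 1) := fun s hs =>
  ⟨(h s hs).1, by
    obtain ⟨j, hj, hs⟩ := (h s hs).2
    exact ⟨j, by omega, hs⟩⟩

theorem Sample.IsDrawnFrom.append {a : ℕ → Fin d → ℝ} {i : ℕ} {M : Sample d}
    (h : M.IsDrawnFrom a i) {p : ℝ} (hp : 0 < p) :
    Sample.IsDrawnFrom a (i + 1) (M ++ [⟨a i, p⟩]) := by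
  intro s hs
  rcases List.mem_append.1 hs with hs | hs
  · exact h.succ s hs
  · rw [List.mem_singleton] at hs
    subst hs
    exact ⟨hp, i, by omega, rfl⟩

theorem Sample.IsDrawnFrom.l1Norm_eq {a : ℕ → Fin d → ℝ} {i : ℕ} {M : Sample d}
    (h : M.IsDrawnFrom a i) (x : Fin d → ℝ) :
    M.l1Norm x = M.weightedSum fun r => |r ⬝ᵥ x| := by
  rw [l1Norm, weightedSum]
  congr 1
  refine List.map_congr_left fun s hs => ?_
  rw [smul_dotProduct, smul_eq_mul, abs_mul, abs_of_pos (inv_pos.2 (h s hs).1)]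

theorem Sample.IsDrawnFrom.l1Norm_le {a : ℕ → Fin d → ℝ} {i : ℕ} {M : Sample d}
    (h : M.IsDrawnFrom a i) (x : Fin d → ℝ) :
    M.l1Norm x ≤ (M.map fun s => s.prob⁻¹).sum * prefixL1 a i x := by
  rw [h.l1Norm_eq, weightedSum, ← List.sum_map_mul_right]
  refine List.sum_le_sum fun s hs => ?_
  obtain ⟨hp, j, hj, hs⟩ := h s hs
  refine mul_le_mul_of_nonneg_left ?_ (inv_nonneg.2 hp.le)
  rw [hs]
  exact abs_dotProduct_le_prefixL1 a hj x

theorem Sample.IsDrawnFrom.abs_l1Norm_sub_le {a : ℕ → Fin d → ℝ} {i : ℕ} {M : Sample d}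
    (h : M.IsDrawnFrom a i) {N : Finset (Fin d → ℝ)}
    (hN : ∀ z, prefixL1 a i z = 1 → ∃ x ∈ N, prefixL1 a i (z - x) ≤ 1 / 5)
    (hM : ∀ x ∈ N, |M.weightedSum (fun r => |r ⬝ᵥ x|) - 1| ≤ 1 / 5) (x : Fin d → ℝ) :
    |M.l1Norm x - prefixL1 a i x| ≤ 1 / 2 * prefixL1 a i x := by
  have := abs_seminorm_sub_le_of_net (prefixL1Seminorm a i) M.l1Seminorm (δ := 1 / 5)
    (η := 1 / 5) (by norm_num) h.l1Norm_le N hN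
    (fun x hx => by rw [M.l1Seminorm_apply, h.l1Norm_eq]; exact hM x hx) x
  norm_num at this ⊢
  exact this

/-- No nonzero row can be discarded by an algorithm that keeps rows with at least the probability
suggested by their online `L₁` sensitivity. -/
def IsDeterministicRegime (a : ℕ → Fin d → ℝ) (n : ℕ) (r : ℝ) : Prop :=
  ∀ i < n, ∀ p : ℝ, 0 ≤ p → p < 1 → (∀ x, r * |a i ⬝ᵥ x| ≤ p * prefixL1 a (i + 1) x) → a i = 0

/-- The properties of the output of the algorithm that hold with high probability. -/
structure IsGoodSample (a : ℕ → Fin d → ℝ) (n : ℕ) (r : ℝ) {ι : Type*} (J : Finset ι)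
    (g : ι → (Fin d → ℝ) → ℝ) (η T : ℝ) (M : Sample d) : Prop where
  drawn : M.IsDrawnFrom a n
  exact : IsDeterministicRegime a n r → ∀ f : (Fin d → ℝ) → ℝ, f 0 = 0 →
    M.weightedSum f = ∑ j ∈ Finset.range n, f (a j)
  deviation : ∀ j ∈ J, |M.weightedSum (g j) - 1| ≤ η
  length_le : (M.length : ℝ) ≤ T

/-- The three summands are the initial values of the three kinds of potential, with `t = η / (2 R)`
minimising `t² R - t η`. For `L₁` deviations `η = 1 / 5` and `R = (α Δ)⁻¹`, whence the exponent `α Δ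
/ 100`. -/
theorem toOuterMeasure_not_isGoodSample_le {a : ℕ → Fin d → ℝ} {n : ℕ} {α Δ : ℝ} (hα : 1 ≤ α)
    (hΔ : 1 ≤ Δ) {N : ℕ → Finset (Fin d → ℝ)} (hN1 : ∀ k, ∀ x ∈ N k, prefixL1 a k x = 1)
    (hN2 : ∀ k, ∀ z, prefixL1 a k z = 1 → ∃ x ∈ N k, prefixL1 a k (z - x) ≤ 1 / 5)
    {w : ℕ → ℝ} (hw0 : ∀ i < n, 0 ≤ w i)
    (hw : ∀ i < n, ∀ x, |a i ⬝ᵥ x| ≤ 2 * w i * prefixL1 a (i + 1) x)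
    {ι : Type*} {J : Finset ι} {g : ι → (Fin d → ℝ) → ℝ} {R η : ℝ} (hR : 0 < R) (hη : 0 < η)
    (hη2 : η ≤ 2) (hg0 : ∀ j ∈ J, ∀ i < n, 0 ≤ g j (a i))
    (hg1 : ∀ j ∈ J, ∑ i ∈ Finset.range n, g j (a i) = 1)
    (hg : ∀ j ∈ J, ∀ i < n, ∀ p : ℝ, 0 ≤ p →
      (∀ x, α * Δ * |a i ⬝ᵥ x| ≤ p * prefixL1 a (i + 1) x) → g j (a i) ≤ p * R) (T : ℝ) :
    (lawFrom α Δ a 0 n []).toOuterMeasure {M | ¬ IsGoodSample a n (α * Δ) J g η T M} ≤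
      ENNReal.ofReal (∑ k ∈ Finset.range n, (N k).card * (2 * Real.exp (-(α * Δ / 100))) +
        J.card * (2 * Real.exp (-(η ^ 2 / (4 * R)))) +
        Real.exp (16 * α * Δ * ∑ i ∈ Finset.range n, w i - T)) := by
  have hαΔ : 0 < α * Δ := by positivity
  set R₁ : ℝ := (α * Δ)⁻¹ with hR₁
  have hR₁0 : 0 < R₁ := inv_pos.2 hαΔ
  set t₁ : ℝ := 1 / 5 / (2 * R₁) with ht₁
  set t₂ : ℝ := η / (2 * R) with ht₂
  have ht₁0 : 0 < t₁ := by positivity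
  have ht₂0 : 0 < t₂ := by positivity
  have ht₁R : t₁ * R₁ ≤ 1 := by rw [ht₁]; field_simp; norm_num
  have ht₂R : t₂ * R ≤ 1 := by rw [ht₂]; field_simp; linarith
  set q : ℕ → ℝ := fun i => 8 * α * Δ * w i with hq
  set V₁ : ℕ → (Fin d → ℝ) → ℕ → Sample d → ℝ := fun k x =>
    deviationPotential a R₁ t₁ (1 / 5) k fun r => |r ⬝ᵥ x| with hV₁
  set V₂ : ι → ℕ → Sample d → ℝ := fun j => deviationPotential a R t₂ η n (g j) with hV₂
  set W : ℕ → Sample d → ℝ := fun i M => ∑ k ∈ Finset.range n, ∑ x ∈ N k, V₁ k x i M +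
    ∑ j ∈ J, V₂ j i M + lengthPotential q n T i M with hW
  have hV₁0 : ∀ k x i M, 0 ≤ V₁ k x i M := fun k x i M => deviationPotential_nonneg _ _ _ _ _ _ _ _
  have hV₂0 : ∀ j i M, 0 ≤ V₂ j i M := fun j i M => deviationPotential_nonneg _ _ _ _ _ _ _ _
  have hs₁ : ∀ i M, 0 ≤ ∑ k ∈ Finset.range n, ∑ x ∈ N k, V₁ k x i M := fun i M =>
    Finset.sum_nonneg fun k _ => Finset.sum_nonneg fun x _ => hV₁0 k x i M
  have hs₂ : ∀ i M, 0 ≤ ∑ j ∈ J, V₂ j i M := fun i M => Finset.sum_nonneg fun j _ => hV₂0 j i M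
  have hs₃ : ∀ i (M : Sample d), 0 ≤ lengthPotential q n T i M := fun i M => Real.exp_nonneg _
  -- The second clause asks for `f 0 = 0` because zero rows are never kept, even in the
  -- deterministic regime.
  set I : ℕ → Sample d → Prop := fun i M => M.IsDrawnFrom a i ∧
    (IsDeterministicRegime a n (α * Δ) → ∀ f : (Fin d → ℝ) → ℝ, f 0 = 0 →
      M.weightedSum f = ∑ j ∈ Finset.range i, f (a j)) with hI
  have hI0 : I 0 [] := ⟨by simp [Sample.IsDrawnFrom], by simp [Sample.weightedSum]⟩
  have hW0 : W 0 [] = ∑ k ∈ Finset.range n, (N k).card * (2 * Real.exp (-(α * Δ / 100))) +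
        J.card * (2 * Real.exp (-(η ^ 2 / (4 * R)))) +
        Real.exp (16 * α * Δ * ∑ i ∈ Finset.range n, w i - T) := by
    simp only [hW, hV₁, hV₂, ht₁, ht₂, deviationPotential_zero_nil a hR,
      deviationPotential_zero_nil a hR₁0, Finset.sum_const, nsmul_eq_mul]
    congr 2
    · refine Finset.sum_congr rfl fun k _ => ?_
      congr 4
      rw [hR₁]
      field_simp
      norm_num
    · rw [lengthPotential, hq, ← Finset.mul_sum]
      simp
      ring
  rw [← hW0]
  refine toOuterMeasure_lawFrom_le (I := I) (W := W) (fun i M => ?_) ?_ ?_ n 0 [] (zero_add n) hI0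
  · exact add_nonneg (add_nonneg (hs₁ i M) (hs₂ i M)) (hs₃ i M)
  · intro i hi M hIM hWM p hp
    have hp0 : 0 ≤ p := hp ▸ NNReal.coe_nonneg _
    have hp1 : p ≤ 1 := hp ▸ samplingProb_le_one _ _ _ _
    -- The total potential is below 1, hence so is each summand with `k = i`: the sample is accurate
    -- at the moment it is consulted.
    have hclose : ∀ x, |M.l1Norm x - prefixL1 a i x| ≤ 1 / 2 * prefixL1 a i x := by
      refine hIM.1.abs_l1Norm_sub_le (hN2 i) fun x hx => ?_
      refine abs_weightedSum_sub_one_le (R := R₁) ht₁0 (hN1 i x hx) (lt_of_le_of_lt ?_ hWM)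
      calc V₁ i x i M ≤ ∑ x ∈ N i, V₁ i x i M :=
            Finset.single_le_sum (f := fun x => V₁ i x i M) (fun x _ => hV₁0 i x i M) hx
        _ ≤ ∑ k ∈ Finset.range n, ∑ x ∈ N k, V₁ k x i M :=
            Finset.single_le_sum (f := fun k => ∑ x ∈ N k, V₁ k x i M)
              (fun k _ => Finset.sum_nonneg fun x _ => hV₁0 k x i M) (Finset.mem_range.2 hi)
        _ ≤ W i M := by
            have := hs₂ i M
            have := hs₃ i M
            simp only [hW]
            linarith
    have hprob : p = 1 ∨ ∀ x, α * Δ * |a i ⬝ᵥ x| ≤ p * prefixL1 a (i + 1) x := by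
      have := samplingProb_eq_one_or_abs_dotProduct_le (Δ := Δ) hα (by linarith) (M := M)
        (P := prefixL1 a i) (fun x => by
          have h1 := (abs_le.1 (hclose x)).2
          have h2 := prefixL1_nonneg a i x
          linarith) (a i)
      rw [← hp] at this
      simpa only [prefixL1_succ] using this
    have hpq : p ≤ q i := by
      rw [hp]
      refine samplingProb_le hα hΔ (P := prefixL1 a i) (fun x => ?_) (hw0 i hi) fun x => ?_
      · have h1 := (abs_le.1 (hclose x)).1
        linarith
      · rw [← prefixL1_succ]
        exact hw i hi x
    have hdet : IsDeterministicRegime a n (α * Δ) → p < 1 → a i = 0 ∧ p = 0 := by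
      intro hdet hlt
      have h0 := hdet i hi p hp0 hlt (hprob.resolve_left hlt.ne)
      refine ⟨h0, ?_⟩
      rw [hp, h0, samplingProb_zero, NNReal.coe_zero]
    refine ⟨fun hpos => ⟨hIM.1.append hpos, fun hD f hf => ?_⟩,
      fun hlt => ⟨hIM.1.succ, fun hD f hf => ?_⟩, ?_⟩
    · have hp_one : p = 1 := by
        by_contra hne
        exact hpos.ne' (hdet hD (lt_of_le_of_ne hp1 hne)).2
      rw [Sample.weightedSum_append, hIM.2 hD f hf, Finset.sum_range_succ, hp_one, inv_one, one_mul]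
    · rw [hIM.2 hD f hf, Finset.sum_range_succ, (hdet hD hlt).1, hf, add_zero]
    · have h1 : p * ∑ k ∈ Finset.range n, ∑ x ∈ N k, V₁ k x (i + 1) (M ++ [⟨a i, p⟩]) +
          (1 - p) * ∑ k ∈ Finset.range n, ∑ x ∈ N k, V₁ k x (i + 1) M ≤
          ∑ k ∈ Finset.range n, ∑ x ∈ N k, V₁ k x i M := by
        refine mul_sum_add_mul_sum_le fun k _ => mul_sum_add_mul_sum_le fun x hx => ?_
        refine deviationPotential_step M hp0 hp1 hR₁0.le ht₁0.le ht₁R (abs_nonneg _) fun hik => ?_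
        refine hprob.imp_right fun h => ?_
        -- For `i < k` the row belongs to the prefix of length `k`, on whose unit sphere `x` lies;
        -- so `|⟨a i, x⟩| ≤ p / (α Δ)`.
        have h2 := prefixL1_mono a (Nat.succ_le_of_lt hik) x
        rw [hN1 k x hx] at h2
        rw [hR₁, ← div_eq_mul_inv, le_div_iff₀ hαΔ, mul_comm]
        exact (h x).trans (mul_le_of_le_one_right hp0 h2)
      have h2 : p * ∑ j ∈ J, V₂ j (i + 1) (M ++ [⟨a i, p⟩]) +
          (1 - p) * ∑ j ∈ J, V₂ j (i + 1) M ≤ ∑ j ∈ J, V₂ j i M := by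
        refine mul_sum_add_mul_sum_le fun j hj => ?_
        exact deviationPotential_step M hp0 hp1 hR.le ht₂0.le ht₂R (hg0 j hj i hi) fun _ =>
          hprob.imp_right fun h => hg j hj i hi p hp0 h
      have h3 := lengthPotential_step (n := n) (T := T) M (a i) hp0 hpq
      simp only [hW]
      linarith
  · intro M hM hIM
    by_contra! hWM
    have hlt₂ : ∑ j ∈ J, V₂ j n M < 1 := by
      have := hs₁ n M
      have := hs₃ n M
      simp only [hW] at hWM
      linarith
    have hlt₃ : lengthPotential q n T n M < 1 := by
      have := hs₁ n M
      have := hs₂ n M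
      simp only [hW] at hWM
      linarith
    refine hM ⟨hIM.1, hIM.2, fun j hj => ?_, ?_⟩
    · refine abs_weightedSum_sub_one_le (R := R) ht₂0 (hg1 j hj) (lt_of_le_of_lt ?_ hlt₂)
      exact Finset.single_le_sum (f := fun j => V₂ j n M) (fun j _ => hV₂0 j n M) hj
    · rw [lengthPotential, Real.exp_lt_one_iff, sub_self, mul_zero, add_zero] at hlt₃
      linarith

end Concentration

/-! ### Subspace embeddings from good samples -/

section Embedding

variable {n d : ℕ}

theorem Sample.sum_get_eq_weightedSum (M : Sample d) (f : (Fin d → ℝ) → ℝ) :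
    ∑ k : Fin M.length, (M.get k).prob⁻¹ * f (M.get k).row = M.weightedSum f := by
  rw [weightedSum, ← List.sum_ofFn]
  congr 1
  conv_rhs => rw [← List.ofFn_get M, List.map_ofFn]
  rfl

variable {G : ℝ → ℝ} {CG : ℝ} {A : Matrix (Fin n) (Fin d) ℝ} {M : Sample d}

theorem Sample.IsDrawnFrom.prob_inv_pos {a : ℕ → Fin d → ℝ} {i : ℕ} (h : M.IsDrawnFrom a i)
    (k : Fin M.length) : 0 < (M.get k).prob⁻¹ :=
  inv_pos.2 (h _ (List.get_mem M k)).1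

/-- The Orlicz norm of the weighted sample as a seminorm. -/
def Sample.IsDrawnFrom.orliczSeminorm {a : ℕ → Fin d → ℝ} {i : ℕ} (h : M.IsDrawnFrom a i)
    (hG : IsOrliczFunction G CG) : Seminorm ℝ (Fin d → ℝ) :=
  (weightedOrliczSeminorm hG h.prob_inv_pos).comp
    (Matrix.mulVecLin (Matrix.of fun k : Fin M.length => (M.get k).row))

theorem Sample.IsDrawnFrom.orliczSeminorm_apply {a : ℕ → Fin d → ℝ} {i : ℕ}
    (h : M.IsDrawnFrom a i) (hG : IsOrliczFunction G CG) (x : Fin d → ℝ) :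
    h.orliczSeminorm hG x = M.orliczNorm G x := rfl

theorem Sample.IsDrawnFrom.orliczNorm_le (h : M.IsDrawnFrom (rowSeq A) n)
    (hG : IsOrliczFunction G CG) :
    ∃ B, ∀ x, M.orliczNorm G x ≤ B * OrliczStream.orliczNorm G (A *ᵥ x) := by
  have hG1 : 0 < G 1 := hG.pos one_pos
  refine ⟨(1 + 1 / G 1) * (1 + (∑ k : Fin M.length, (M.get k).prob⁻¹) * G 1), fun x => ?_⟩
  have hx : 0 ≤ OrliczStream.orliczNorm G (A *ᵥ x) :=
    weightedOrliczNorm_nonneg hG (fun _ => one_pos) _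
  have := weightedOrliczNorm_le_of_abs_le hG h.prob_inv_pos
    (v := fun k : Fin M.length => (M.get k).row ⬝ᵥ x)
    (r := (1 + 1 / G 1) * OrliczStream.orliczNorm G (A *ᵥ x)) (by positivity) (fun k => by
      obtain ⟨-, j, hj, hk⟩ := h _ (List.get_mem M k)
      rw [hk, rowSeq_of_lt A hj]
      exact abs_apply_le_mul_orliczNorm hG (A *ᵥ x) ⟨j, hj⟩)
  refine this.trans (le_of_eq ?_)
  ring

theorem isSubspaceEmbedding_of_net (hG : IsOrliczFunction G CG) (h : M.IsDrawnFrom (rowSeq A) n)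
    {ε : ℝ} (hε : 0 < ε) (hε1 : ε ≤ 1) {N : Finset (Fin d → ℝ)}
    (hN : ∀ z, orliczNorm G (A *ᵥ z) = 1 →
      ∃ x ∈ N, orliczSeminorm hG A (z - x) ≤ ε / 4)
    (hM : ∀ x ∈ N, |M.weightedSum (fun r => G (r ⬝ᵥ x)) - 1| ≤ ε / 4) :
    IsSubspaceEmbedding G A ε M := by
  intro x
  obtain ⟨B, hB⟩ := h.orliczNorm_le hG
  have := abs_seminorm_sub_le_of_net (orliczSeminorm hG A) (h.orliczSeminorm hG) (δ := ε / 4)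
    (η := ε / 4) (by linarith) hB N hN (fun x hx => by
      rw [h.orliczSeminorm_apply hG]
      refine abs_weightedOrliczNorm_sub_one_le hG h.prob_inv_pos (by linarith) ?_
      rw [M.sum_get_eq_weightedSum fun r => G (r ⬝ᵥ x)]
      exact hM x hx) x
  refine this.trans (mul_le_mul_of_nonneg_right ?_ (apply_nonneg (orliczSeminorm hG A) x))
  -- `(ε / 4 + ε / 4) / (1 - ε / 4) ≤ ε` as `ε ≤ 1`.
  rw [div_le_iff₀ (by linarith)]
  nlinarith

theorem isSubspaceEmbedding_of_weightedSum_eq (hG : IsOrliczFunction G CG)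
    (h : M.IsDrawnFrom (rowSeq A) n) {ε : ℝ} (hε : 0 ≤ ε)
    (hM : ∀ f : (Fin d → ℝ) → ℝ, f 0 = 0 →
      M.weightedSum f = ∑ j ∈ Finset.range n, f (rowSeq A j)) :
    IsSubspaceEmbedding G A ε M := by
  intro x
  have heq : M.orliczNorm G x = orliczNorm G (A *ᵥ x) := by
    by_cases hx : A *ᵥ x = 0
    · obtain ⟨B, hB⟩ := h.orliczNorm_le hG
      have h0 : orliczNorm G (A *ᵥ x) = 0 := by
        rw [hx, orliczNorm, weightedOrliczNorm_zero hG]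
      have h1 := hB x
      rw [h0, mul_zero] at h1
      rw [h0]
      exact le_antisymm h1 (weightedOrliczNorm_nonneg hG h.prob_inv_pos _)
    · obtain ⟨hpos, hsum⟩ := weightedOrliczNorm_spec hG (w := fun _ : Fin n => 1)
        (fun _ => one_pos) hx
      refine weightedOrliczNorm_eq hG h.prob_inv_pos hpos ?_
      rw [← hsum, M.sum_get_eq_weightedSum fun r =>
        G (|r ⬝ᵥ x| / orliczNorm G (A *ᵥ x)), hM _ (by simp [hG.map_zero]),
        Finset.sum_range]
      simp only [rowSeq_val, one_mul]
      rfl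
  rw [heq, sub_self, abs_zero]
  exact mul_nonneg hε (weightedOrliczNorm_nonneg hG (fun _ => one_pos) _)

end Embedding

/-! ### Parameters -/

section Parameters

theorem abs_dotProduct_le_of_abs_le {d : ℕ} {u v : Fin d → ℝ} {B : ℝ} (hu : ∀ j, |u j| ≤ B)
    (hv : ∀ j, |v j| ≤ B) : |u ⬝ᵥ v| ≤ d * B ^ 2 := by
  calc |u ⬝ᵥ v| ≤ ∑ j, |u j * v j| := Finset.abs_sum_le_sum_abs _ _
    _ ≤ ∑ _j : Fin d, B ^ 2 := by
      refine Finset.sum_le_sum fun j _ => ?_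
      rw [abs_mul, sq]
      exact mul_le_mul (hu j) (hv j) (abs_nonneg _) ((abs_nonneg _).trans (hu j))
    _ = d * B ^ 2 := by simp

theorem one_le_dotProduct_self_of_int {d : ℕ} {v : Fin d → ℝ} (hv : ∀ j, ∃ z : ℤ, v j = z)
    (h0 : v ≠ 0) : 1 ≤ v ⬝ᵥ v := by
  obtain ⟨j, hj⟩ := Function.ne_iff.1 h0
  obtain ⟨z, hz⟩ := hv j
  have h1 : 1 ≤ v j * v j := by
    rw [hz] at hj ⊢
    have hz0 : z ≠ 0 := by
      intro h; apply hj; simp [h]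
    have : (1 : ℤ) ≤ z * z := by
      rcases lt_or_gt_of_ne hz0 with h | h <;> nlinarith
    exact_mod_cast this
  exact h1.trans (Finset.single_le_sum (f := fun j => v j * v j) (fun _ _ => mul_self_nonneg _)
    (Finset.mem_univ j))

/-- Test with `x = a i`: a nonzero integer row has `⟨a i, a i⟩ ≥ 1`, while the prefix norm is at
most `d n^(2b+1) ≤ r`, so `p < 1` is impossible. -/
theorem isDeterministicRegime_of_le {n d b : ℕ} {A : Matrix (Fin n) (Fin d) ℝ}
    (hA : ∀ i j, ∃ z : ℤ, A i j = (z : ℝ) ∧ |z| ≤ (n : ℤ) ^ b) {r : ℝ}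
    (hr : (d : ℝ) * n ^ (2 * b + 1) ≤ r) : IsDeterministicRegime (rowSeq A) n r := by
  intro i hi p hp0 hp1 h
  by_contra hne
  rw [rowSeq_of_lt A hi] at hne
  have hrow : ∀ k : Fin n, ∀ j, |A k j| ≤ (n : ℝ) ^ b := fun k j => by
    obtain ⟨z, hz, hzb⟩ := hA k j
    rw [hz]
    exact_mod_cast hzb
  have h1 := one_le_dotProduct_self_of_int (fun j => (hA ⟨i, hi⟩ j).imp fun z hz => hz.1) hne
  have hx := h (A ⟨i, hi⟩)
  have hpre : prefixL1 (rowSeq A) (i + 1) (A ⟨i, hi⟩) ≤ d * n ^ (2 * b + 1) := by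
    refine (prefixL1_mono _ (Nat.succ_le_of_lt hi) _).trans ?_
    rw [prefixL1_rowSeq]
    calc ∑ j, |A j ⬝ᵥ A ⟨i, hi⟩| ≤ ∑ _j : Fin n, (d : ℝ) * ((n : ℝ) ^ b) ^ 2 :=
          Finset.sum_le_sum fun j _ => abs_dotProduct_le_of_abs_le (hrow j) (hrow _)
      _ = d * n ^ (2 * b + 1) := by
        rw [Finset.sum_const, Finset.card_univ, Fintype.card_fin, nsmul_eq_mul]; ring
  have hd : 0 < d := by
    rcases Nat.eq_zero_or_pos d with rfl | hd
    · exact absurd (Subsingleton.elim _ _) hne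
    · exact hd
  have hpos : 0 < (d : ℝ) * n ^ (2 * b + 1) := by
    have : 0 < n := by omega
    positivity
  rw [rowSeq_of_lt A hi] at hx
  have h2 : r * 1 ≤ r * |A ⟨i, hi⟩ ⬝ᵥ A ⟨i, hi⟩| :=
    mul_le_mul_of_nonneg_left (h1.trans (le_abs_self _)) (hpos.le.trans hr)
  have h3 := mul_le_mul_of_nonneg_left hpre hp0
  nlinarith

theorem exp_neg_le_inv_pow {n : ℕ} (hn : 2 ≤ n) (m : ℕ) {X : ℝ} (h : m * Real.log n ≤ X) :
    Real.exp (-X) ≤ ((n : ℝ) ^ m)⁻¹ := by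
  have hn0 : (0 : ℝ) < n := by exact_mod_cast (by omega : 0 < n)
  rw [Real.exp_neg]
  apply inv_anti₀ (by positivity)
  rw [← Real.log_le_iff_le_exp (by positivity), Real.log_pow]
  exact h

theorem three_mul_inv_pow_le {n : ℕ} (hn : 2 ≤ n) (c : ℕ) :
    3 * ((n : ℝ) ^ (c + 2))⁻¹ ≤ 1 / (n : ℝ) ^ c := by
  have hn2 : (2 : ℝ) ≤ n := by exact_mod_cast hn
  have hp : (0 : ℝ) < (n : ℝ) ^ c := by positivity
  rw [pow_add, mul_inv, one_div, ← mul_assoc, mul_comm 3, mul_assoc]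
  refine mul_le_of_le_one_right (by positivity) ?_
  rw [← div_eq_mul_inv, div_le_one (by positivity)]
  nlinarith

end Parameters

/-! ### Failure probabilities for the chosen parameters -/

theorem sampleLaw_zero {n d : ℕ} (α Δ : ℝ) :
    (sampleLaw α Δ (0 : Matrix (Fin n) (Fin d) ℝ)).toOuterMeasure {M | M ≠ []} = 0 := by
  rw [sampleLaw_eq_lawFrom]
  have hrow : ∀ i, rowSeq (0 : Matrix (Fin n) (Fin d) ℝ) i = 0 := fun i => by
    rw [rowSeq]; split_ifs <;> rfl
  have := toOuterMeasure_lawFrom_le (α := α) (Δ := Δ) (a := rowSeq (0 : Matrix (Fin n) (Fin d) ℝ))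
    (n := n) (I := fun _ M => M = []) (W := fun _ _ => 0) (s := {M | M ≠ []}) (fun _ _ => le_rfl)
    (fun i _ M hM _ p hp => by
      have h0 : p = 0 := by rw [hp, hrow, samplingProb_zero, NNReal.coe_zero]
      exact ⟨fun h => absurd h0 h.ne', fun _ => hM, by simp⟩)
    (fun M hM hM' => absurd hM' hM) n 0 [] (zero_add n) rfl
  simpa using this

theorem toOuterMeasure_not_isGoodSample_le_inv_pow {n d : ℕ} (hn : 2 ≤ n) (hd : 1 ≤ d) {b c : ℕ}
    {CG C ε Δ κ : ℝ} (hC : 1024 * max CG 1 * (b + c + 8) ≤ C) (hε : 0 < ε) (hε2 : ε < 1 / 2)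
    (hΔ : 1 ≤ Δ) {A : Matrix (Fin n) (Fin d) ℝ}
    (hA : ∀ i j, ∃ z : ℤ, A i j = (z : ℝ) ∧ |z| ≤ (n : ℤ) ^ b) (hκ : 2 ≤ κ)
    (hAκ : streamConditionNumber A ≤ κ) {ι : Type*} {J : Finset ι} {g : ι → (Fin d → ℝ) → ℝ}
    (hg0 : ∀ j ∈ J, ∀ i < n, 0 ≤ g j (rowSeq A i))
    (hg1 : ∀ j ∈ J, ∑ i ∈ Finset.range n, g j (rowSeq A i) = 1)
    (hg : ∀ j ∈ J, ∀ i < n, ∀ p : ℝ, 0 ≤ p → (∀ x, oversampling C n d ε * Δ * |rowSeq A i ⬝ᵥ x| ≤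
      p * prefixL1 (rowSeq A) (i + 1) x) →
        g j (rowSeq A i) ≤ p * (16 * max CG 1 / oversampling C n d ε))
    (hJ : (J.card : ℝ) ≤ (n : ℝ) ^ ((b + 5) * d)) :
    (sampleLaw (oversampling C n d ε) Δ A).toOuterMeasure
      {M | ¬ IsGoodSample (rowSeq A) n (oversampling C n d ε * Δ) J g (ε / 4)
        (16 * oversampling C n d ε * Δ * (4 * (b + 4) * (d * Real.log n * Real.log κ)) +
          (c + 2) * Real.log n) M} ≤
      ENNReal.ofReal (1 / (n : ℝ) ^ c) := by
  have hn2 : (2 : ℝ) ≤ n := by exact_mod_cast hn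
  have hn0 : (0 : ℝ) < n := by linarith
  have hd1 : (1 : ℝ) ≤ d := by exact_mod_cast hd
  have hb0 : (0 : ℝ) ≤ b := Nat.cast_nonneg b
  have hc0 : (0 : ℝ) ≤ c := Nat.cast_nonneg c
  have hln : 0.69 ≤ Real.log n := by
    have := Real.log_le_log two_pos hn2
    have := Real.log_two_gt_d9
    linarith
  set C₁ := max CG 1 with hC₁
  have hC₁1 : 1 ≤ C₁ := le_max_right _ _
  set l := Real.log n with hl
  have hCbig : 1024 * (b + c + 8) ≤ C := by
    refine le_trans ?_ hC
    have : 1024 * ((b : ℝ) + c + 8) * 1 ≤ 1024 * (b + c + 8) * C₁ :=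
      mul_le_mul_of_nonneg_left hC₁1 (by positivity)
    linarith
  have hC0 : 0 < C := by linarith
  set α := oversampling C n d ε with hα
  have hαeq : α * ε ^ 2 = C * d * l := by rw [hα, oversampling, ← hl]; field_simp
  have hα4 : 4 * (C * d * l) ≤ α := by
    have h1 : 4 * ε ^ 2 ≤ 1 := by nlinarith
    have h2 : 0 ≤ C * d * l := by positivity
    have h3 : 0 < α := by rw [hα, oversampling]; positivity
    nlinarith
  have hdl : 0.69 ≤ d * l := by nlinarith
  have hα1 : 1 ≤ α := by nlinarith
  have hα0 : 0 < α := by linarith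
  obtain ⟨w, hw0, hw, hwsum⟩ := exists_online_sensitivities b hn A hA hκ hAκ
  have hnet : ∀ k, ∃ N : Finset (Fin d → ℝ), (N.card : ℝ) ≤ 11 ^ d ∧
      (∀ x ∈ N, prefixL1 (rowSeq A) k x = 1) ∧
      ∀ z, prefixL1 (rowSeq A) k z = 1 → ∃ x ∈ N, prefixL1 (rowSeq A) k (z - x) ≤ 1 / 5 := by
    intro k
    obtain ⟨N, hN, hN1, hN2⟩ := exists_seminorm_net (prefixL1Seminorm (rowSeq A) k)
      (δ := 1 / 5) (by norm_num)
    refine ⟨N, ?_, hN1, hN2⟩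
    rw [Module.finrank_fin_fun] at hN
    norm_num at hN
    exact hN
  choose N hNcard hN1 hN2 using hnet
  rw [sampleLaw_eq_lawFrom]
  refine (toOuterMeasure_not_isGoodSample_le hα1 hΔ hN1 hN2 hw0 hw (R := 16 * C₁ / α)
    (by positivity) (by positivity) (by linarith) hg0 hg1 hg _).trans
    (ENNReal.ofReal_le_ofReal ?_)
  refine le_trans ?_ (three_mul_inv_pow_le hn c)
  have hnc : 0 < (n : ℝ) ^ (c + 2) := by positivity
  have t1 : ∑ k ∈ Finset.range n, ((N k).card : ℝ) * (2 * Real.exp (-(α * Δ / 100))) ≤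
      ((n : ℝ) ^ (c + 2))⁻¹ := by
    have he : Real.exp (-(α * Δ / 100)) ≤ ((n : ℝ) ^ (4 * d + 1 + 1 + (c + 2)))⁻¹ := by
      refine exp_neg_le_inv_pow hn _ ?_
      push_cast
      have h1 : α * 1 ≤ α * Δ := mul_le_mul_of_nonneg_left hΔ hα0.le
      have h2 : 1024 * (c + 8) * (d * l) ≤ C * d * l := by
        rw [mul_assoc C]
        exact mul_le_mul_of_nonneg_right (by linarith) (by positivity)
      have h3 : (4 * (d : ℝ) + 1 + 1 + (c + 2)) ≤ 40 * (c + 8) * d := by nlinarith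
      have h4 := mul_le_mul_of_nonneg_right h3 (by positivity : 0 ≤ l)
      have h5 : 0 ≤ (c + 8) * (d * l) := by positivity
      linarith
    -- `11 = 1 + 2 / (1 / 5)` is the volume bound for radius `1 / 5`, and `11 ≤ 2 ^ 4`.
    have h11 : (11 : ℝ) ^ d ≤ (n : ℝ) ^ (4 * d) := by
      rw [pow_mul]
      refine pow_le_pow_left₀ (by norm_num) ?_ d
      have := pow_le_pow_left₀ (by norm_num) hn2 4
      norm_num at this
      linarith
    calc ∑ k ∈ Finset.range n, ((N k).card : ℝ) * (2 * Real.exp (-(α * Δ / 100)))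
        ≤ ∑ k ∈ Finset.range n, (n : ℝ) ^ (4 * d) * (n * ((n : ℝ) ^ (4 * d + 1 + 1 + (c + 2)))⁻¹) := by
          refine Finset.sum_le_sum fun k _ => ?_
          gcongr
          exact (hNcard k).trans h11
      _ = ((n : ℝ) ^ (c + 2))⁻¹ := by
          rw [Finset.sum_const, Finset.card_range, nsmul_eq_mul]
          field_simp
          ring
  have t2 : (J.card : ℝ) * (2 * Real.exp (-((ε / 4) ^ 2 / (4 * (16 * C₁ / α))))) ≤
      ((n : ℝ) ^ (c + 2))⁻¹ := by
    have he : Real.exp (-((ε / 4) ^ 2 / (4 * (16 * C₁ / α)))) ≤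
        ((n : ℝ) ^ ((b + 5) * d + 1 + (c + 2)))⁻¹ := by
      refine exp_neg_le_inv_pow hn _ ?_
      -- The constant `1024 = 4² * 4 * 16` in the lower bound for `C` comes from here.
      have h1 : (ε / 4) ^ 2 / (4 * (16 * C₁ / α)) = C * d * l / (1024 * C₁) := by
        rw [← hαeq]; field_simp; norm_num
      rw [h1, le_div_iff₀ (by positivity)]
      push_cast
      have h2 : 1024 * C₁ * (b + c + 8) * (d * l) ≤ C * (d * l) :=
        mul_le_mul_of_nonneg_right hC (by positivity)
      have h3 : (((b : ℝ) + 5) * d + 1 + (c + 2)) ≤ (b + c + 8) * d := by nlinarith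
      have h4 := mul_le_mul_of_nonneg_right h3 (by positivity : 0 ≤ l * (1024 * C₁))
      linarith
    calc (J.card : ℝ) * (2 * Real.exp (-((ε / 4) ^ 2 / (4 * (16 * C₁ / α)))))
        ≤ (n : ℝ) ^ ((b + 5) * d) * (n * ((n : ℝ) ^ ((b + 5) * d + 1 + (c + 2)))⁻¹) := by
          gcongr
      _ = ((n : ℝ) ^ (c + 2))⁻¹ := by
          field_simp
          ring
  have t3 : Real.exp (16 * α * Δ * ∑ i ∈ Finset.range n, w i -
      (16 * α * Δ * (4 * (b + 4) * (d * l * Real.log κ)) + (c + 2) * l)) ≤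
      ((n : ℝ) ^ (c + 2))⁻¹ := by
    refine le_trans (Real.exp_le_exp.2 ?_) (exp_neg_le_inv_pow hn (c + 2) le_rfl)
    have := mul_le_mul_of_nonneg_left hwsum (by positivity : 0 ≤ 16 * α * Δ)
    push_cast
    linarith
  linarith

end OrliczStream

end

/-! ### Assembly -/

theorem mainTheorem4 (CG : ℝ) (b c : ℕ) :
    ∃ C₀ : ℝ, 0 < C₀ ∧ ∀ C : ℝ, C₀ ≤ C → ∃ K : ℝ, 0 < K ∧
      ∀ (G : ℝ → ℝ), OrliczStream.IsOrliczFunction G CG →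
      ∀ (n d : ℕ), 2 ≤ n →
      ∀ (A : Matrix (Fin n) (Fin d) ℝ),
        (∀ i j, ∃ z : ℤ, A i j = (z : ℝ) ∧ |z| ≤ (n : ℤ) ^ b) →
      ∀ κ : ℝ, 2 ≤ κ → OrliczStream.streamConditionNumber A ≤ κ →
      ∀ ε : ℝ, 0 < ε → ε < 1 / 2 →
      ∀ (N : Set (Fin d → ℝ)), OrliczStream.IsOrliczNet G A ε N →
      ∀ (Δ₁ Δ₂ : ℝ), 0 < Δ₁ → 0 < Δ₂ →
        (∀ x ∈ N, ∀ j, A j ⬝ᵥ x ≠ 0 → Δ₁ ≤ |A j ⬝ᵥ x| ∧ |A j ⬝ᵥ x| ≤ Δ₂) →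
      ∀ Δ : ℝ, (G Δ₂ * Δ₁) / (G Δ₁ * Δ₂) ≤ Δ →
        ENNReal.ofReal (1 - 1 / (n : ℝ) ^ c) ≤
          (OrliczStream.sampleLaw (OrliczStream.oversampling C n d ε) Δ A).toOuterMeasure
            {M | OrliczStream.IsSubspaceEmbedding G A ε M ∧
              (M.length : ℝ) ≤
                K * ((d : ℝ) ^ 2 * Δ / ε ^ 2 * Real.log n ^ 2 * Real.log κ)} := by
  open OrliczStream in
  have hb0 : (0 : ℝ) ≤ b := Nat.cast_nonneg b
  have hc0 : (0 : ℝ) ≤ c := Nat.cast_nonneg c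
  have hC₁1 : 1 ≤ max CG 1 := le_max_right _ _
  refine ⟨1024 * max CG 1 * (b + c + 8), by positivity, fun C hC => ?_⟩
  have hC1 : 1 ≤ C := by nlinarith
  refine ⟨64 * C * (b + 4) + (c + 2), by positivity, ?_⟩
  intro G hG n d hn A hA κ hκ hAκ ε hε hε2 N hN Δ₁ Δ₂ hΔ₁ hΔ₂ hΔN Δ hΔ
  have hn2 : (2 : ℝ) ≤ n := by exact_mod_cast hn
  have hn0 : (0 : ℝ) < n := by linarith
  have hl2 := Real.log_two_gt_d9
  have hln : 0.69 ≤ Real.log n := by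
    have := Real.log_le_log two_pos hn2
    linarith
  have hlκ : 0.69 ≤ Real.log κ := by
    have := Real.log_le_log two_pos hκ
    linarith
  -- The Orlicz sphere is empty for `A = 0`, so `1 ≤ Δ` is unavailable; but then the sample is
  -- almost surely empty.
  by_cases hA0 : A = 0
  · subst hA0
    have hΔ0 : 0 ≤ Δ := by
      have := hG.pos hΔ₁
      have := hG.pos hΔ₂
      exact le_trans (by positivity) hΔ
    refine ofReal_one_sub_le_toOuterMeasure _ (t := {M | M ≠ []}) (by positivity)
      (by rw [sampleLaw_zero]; exact zero_le) ?_
    intro M hM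
    rw [Set.mem_ofPred_eq, not_not] at hM
    subst hM
    refine ⟨fun x => ?_, by rw [List.length_nil, Nat.cast_zero]; positivity⟩
    have h0 : orliczNorm G ((0 : Matrix (Fin n) (Fin d) ℝ) *ᵥ x) = 0 := by
      rw [Matrix.zero_mulVec, orliczNorm, weightedOrliczNorm_zero hG]
    have h1 : Sample.orliczNorm G ([] : Sample d) x = 0 := by
      rw [Sample.orliczNorm, weightedOrliczNorm, dif_neg]
      simp
    rw [h0, h1]
    simp
  have hd : 1 ≤ d := by
    by_contra! hd
    obtain rfl : d = 0 := by omega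
    exact hA0 (Matrix.ext fun i j => j.elim0)
  have hd1 : (1 : ℝ) ≤ d := by exact_mod_cast hd
  have hΔ1 : 1 ≤ Δ := (one_le_of_isOrliczNet hG hA0 hN hΔ₁ hΔ₂ hΔN).trans hΔ
  set α := oversampling C n d ε with hα
  have hα0 : 0 < α := by rw [hα, oversampling]; positivity
  obtain ⟨S, hScard, hS1, hS2⟩ := exists_seminorm_net (orliczSeminorm hG A)
    (show 0 < ε / 4 by positivity)
  rw [Module.finrank_fin_fun] at hScard
  have hlen : 16 * α * Δ * (4 * (b + 4) * (d * Real.log n * Real.log κ)) + (c + 2) * Real.log n ≤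
      (64 * C * (b + 4) + (c + 2)) *
        ((d : ℝ) ^ 2 * Δ / ε ^ 2 * Real.log n ^ 2 * Real.log κ) := by
    have h1 : 4 ≤ (d : ℝ) ^ 2 * Δ / ε ^ 2 := by
      rw [le_div_iff₀ (by positivity)]
      have : 1 ≤ (d : ℝ) ^ 2 * Δ := one_le_mul_of_one_le_of_one_le (one_le_pow₀ hd1) hΔ1
      nlinarith
    have h2 : 0.69 * 0.69 ≤ Real.log n * Real.log κ :=
      mul_le_mul hln hlκ (by norm_num) (by linarith)
    have h3 : 1 ≤ (d : ℝ) ^ 2 * Δ / ε ^ 2 * (Real.log n * Real.log κ) := by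
      have := mul_le_mul h1 h2 (by norm_num) (by linarith)
      linarith
    have h4 : Real.log n ≤ (d : ℝ) ^ 2 * Δ / ε ^ 2 * Real.log n ^ 2 * Real.log κ := by
      have := mul_le_mul_of_nonneg_left h3 (by linarith : 0 ≤ Real.log n)
      linarith
    have h5 := mul_le_mul_of_nonneg_left h4 (by positivity : 0 ≤ (c : ℝ) + 2)
    have h6 : 16 * α * Δ * (4 * (b + 4) * (d * Real.log n * Real.log κ)) =
        64 * C * (b + 4) * ((d : ℝ) ^ 2 * Δ / ε ^ 2 * Real.log n ^ 2 * Real.log κ) := by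
      rw [hα, oversampling]; ring
    rw [h6, add_mul]
    linarith
  -- To be used with `J = ∅` when `ε` is tiny, where the net is too large for a union bound but
  -- exactness replaces concentration, and with `J = S` otherwise.
  have hgood : ∀ J : Finset (Fin d → ℝ), (J.card : ℝ) ≤ (n : ℝ) ^ ((b + 5) * d) → J ⊆ S →
      (sampleLaw α Δ A).toOuterMeasure {M | ¬ IsGoodSample (rowSeq A) n (α * Δ) J
        (fun x r => G (r ⬝ᵥ x)) (ε / 4)
        (16 * α * Δ * (4 * (b + 4) * (d * Real.log n * Real.log κ)) + (c + 2) * Real.log n) M} ≤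
      ENNReal.ofReal (1 / (n : ℝ) ^ c) := by
    intro J hJ hJS
    refine toOuterMeasure_not_isGoodSample_le_inv_pow hn hd hC hε hε2 hΔ1 hA hκ hAκ
      (fun x _ i _ => hG.nonneg _) (fun x hx => ?_) (fun x hx i hi p hp h => ?_) hJ
    · rw [Finset.sum_range]
      simp only [rowSeq_val]
      exact sum_apply_eq_one_of_orliczNorm_eq_one hG (hS1 x (hJS hx))
    · have hαΔ : 0 < α * Δ := by positivity
      have hi' : ∀ y, |A ⟨i, hi⟩ ⬝ᵥ y| ≤ p / (α * Δ) * ∑ j, |A j ⬝ᵥ y| := by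
        intro y
        have h1 := h y
        rw [rowSeq_of_lt A hi] at h1
        rw [div_mul_eq_mul_div, le_div_iff₀ hαΔ, ← prefixL1_rowSeq, mul_comm]
        exact h1.trans (mul_le_mul_of_nonneg_left
          (prefixL1_mono _ (Nat.succ_le_of_lt hi) y) hp)
      rw [rowSeq_of_lt A hi]
      refine (apply_le_mul_of_isOrliczNet hG hε2 hN hΔ₁ hΔ₂ hΔN (by positivity) hi'
        (hS1 x (hJS hx))).trans ?_
      calc 16 * max CG 1 * (G Δ₂ * Δ₁ / (G Δ₁ * Δ₂) * (p / (α * Δ)))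
          ≤ 16 * max CG 1 * (Δ * (p / (α * Δ))) := by gcongr
        _ = p * (16 * max CG 1 / α) := by field_simp
  rcases le_or_gt (ε * (n : ℝ) ^ (b + 1)) 1 with htiny | htiny
  · refine ofReal_one_sub_le_toOuterMeasure _ (by positivity)
      (hgood ∅ (by simp) (Finset.empty_subset _)) ?_
    intro M hM
    rw [Set.mem_ofPred_eq, not_not] at hM
    refine ⟨isSubspaceEmbedding_of_weightedSum_eq hG hM.drawn hε.le (hM.exact ?_),
      hM.length_le.trans hlen⟩
    refine isDeterministicRegime_of_le hA ?_
    -- This exceeds the required `n^(2b+1)` by a factor `n ≥ 2`, which compensates for `C * log n`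
    -- being bounded below only by `1 / 2`.
    have h1 : (n : ℝ) ^ (2 * b + 2) ≤ 1 / ε ^ 2 := by
      rw [le_div_iff₀ (by positivity)]
      have := pow_le_one₀ (by positivity) htiny (n := 2)
      rw [mul_pow, ← pow_mul] at this
      rw [mul_comm]
      convert this using 3
      ring
    have hCl : 0.5 ≤ C * Real.log n := by nlinarith
    have hp0 : (0 : ℝ) < (n : ℝ) ^ (2 * b + 1) := by positivity
    have hαd : (d : ℝ) * n ^ (2 * b + 1) ≤ α := by
      have e : α = d * (C * Real.log n * (1 / ε ^ 2)) := by rw [hα, oversampling]; ring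
      rw [e]
      refine mul_le_mul_of_nonneg_left ?_ (by linarith)
      calc (n : ℝ) ^ (2 * b + 1) ≤ 0.5 * (n : ℝ) ^ (2 * b + 2) := by
            rw [pow_succ _ (2 * b + 1)]; nlinarith
        _ ≤ C * Real.log n * (1 / ε ^ 2) := mul_le_mul hCl h1 (by positivity) (by linarith)
    exact hαd.trans (le_mul_of_one_le_right hα0.le hΔ1)
  · refine ofReal_one_sub_le_toOuterMeasure _ (by positivity) (hgood S ?_ subset_rfl) ?_
    · refine hScard.trans ?_
      rw [pow_mul]
      refine pow_le_pow_left₀ (by positivity) ?_ d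
      have h1 : 1 / ε ≤ (n : ℝ) ^ (b + 1) := by
        rw [div_le_iff₀ hε]; linarith
      have h2 : 1 ≤ 1 / ε := by rw [le_div_iff₀ hε]; linarith
      have h16 : (16 : ℝ) ≤ (n : ℝ) ^ 4 := by
        have := pow_le_pow_left₀ (by norm_num) hn2 4
        norm_num at this
        exact this
      calc 1 + 2 / (ε / 4) = 1 + 8 * (1 / ε) := by field_simp; norm_num
        _ ≤ 16 * (1 / ε) := by linarith
        _ ≤ (n : ℝ) ^ 4 * (n : ℝ) ^ (b + 1) := mul_le_mul h16 h1 (by positivity) (by positivity)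
        _ = (n : ℝ) ^ (b + 5) := by ring
    · intro M hM
      rw [Set.mem_ofPred_eq, not_not] at hM
      exact ⟨isSubspaceEmbedding_of_net hG hM.drawn hε (by linarith) hS2 hM.deviation,
        hM.length_le.trans hlen⟩
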